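/- Let $d\ge 1$ be an integer and let $s>d$ be real. For $R>0$ let $K_R\subset\mathbb R^d$ be the (closed) hypercube of center $0$ and sidelength $R$, with sides parallel to the coordinate axes. For $\omega_N=(x_1,\dots,x_N)\in(\mathbb R^d)^N$ put $$E_s(\omega_N)=\sum_{1\le i\ne j\le N}\frac1{|x_i-x_j|^s}\in[0,+\infty],\qquad E_s(A,N)=\inf_{\omega_N\in A^N}E_s(\omega_N)\quad(A\subset\mathbb R^d),$$ with $1/0=+\infty$. A point configuration $\mathcal C$ is a locally finite collection of points of $\mathbb R^d$, points with multiplicity being allowed. Its density and its Riesz $s$-energy are $$\mathrm{Dens}(\mathcal C)=\liminf_{R\to\infty}\frac{|\mathcal C\cap K_R|}{R^d},\qquad \mathcal W_s(\mathcal C)=\liminf_{R\to\infty}\frac1{R^d}\sum_{p\ne q\in\mathcal C\cap K_R}\frac1{|p-q|^s}\in[0,+\infty],$$ where points are counted with multiplicity and the sum is over ordered pairs of different points of the collection (two different points at the same location contribute $+\infty$). Let $\mathrm{Config}_1$ be the set of point configurations of density $1$. Then the limit $$C_{s,d}:=\lim_{N\to\infty}\frac{E_s(K_1,N)}{N^{1+s/d}}$$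 exists and is a positive real number, and $$\inf_{\mathcal C\in\mathrm{Config}_1}\mathcal W_s(\mathcal C)=\min_{\mathcal C\in\mathrm{Config}_1}\mathcal W_s(\mathcal C)=C_{s,d};$$ in particular the infimum is attained. Moreover, for every $d$-dimensional Bravais lattice (full-rank lattice) $\Lambda\subset\mathbb R^d$ of covolume $1$ there is a sequence $(\mathcal C_N)_{N\ge1}$ in $\mathrm{Config}_1$ such that $\mathcal C_N$ is $N^{1/d}\Lambda$-periodic (invariant under translation by every vector of $N^{1/d}\Lambda$) for each $N\ge1$ and $\lim_{N\to\infty}\mathcal W_s(\mathcal C_N)=C_{s,d}$. -/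

import Mathlib

open Filter Topology
open scoped ENNReal

noncomputable section

namespace HypersingularRiesz

/-- Euclidean space `ℝ^d`, with its Euclidean norm. -/
abbrev Space (d : ℕ) : Type := EuclideanSpace ℝ (Fin d)

/-- The closed hypercube `K_R` of center `0` and sidelength `R`. -/
def cube (d : ℕ) (R : ℝ) : Set (Space d) := {x | ∀ i, |x i| ≤ R / 2}

/-- A locally finite point configuration in `ℝ^d`, given by its multiplicity function: `C p` is the
number of particles at the point `p`, i.e. the mass which the Radon measure `∑_{p ∈ C} δ_p`
gives to `{p}`. -/
abbrev Config (d : ℕ) : Type := Function.locallyFinsupp (Space d) ℕ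

/-- The Riesz kernel `1 / |x - y|^s`, with the value `∞` at `x = y` (for `s > 0`). -/
def riesz {d : ℕ} (s : ℝ) (x y : Space d) : ℝ≥0∞ := (edist x y) ^ (-s)

/-- The number of points, counted with multiplicity, of the configuration `C` in `A`. -/
def Config.count {d : ℕ} (C : Config d) (A : Set (Space d)) : ℝ≥0∞ :=
  ∑' p : A, (C (p : Space d) : ℝ≥0∞)

/-- The number of ordered pairs of different particles of `C`, the first one located at `p` and
the second one located at `q`. -/
def Config.pairs {d : ℕ} (C : Config d) (p q : Space d) : ℕ :=
  open scoped Classical in if p = q then C p * (C p - 1) else C p * C q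

/-- The Riesz interaction `Int[A, B](C)`: the sum of `1 / |p - q|^s` over the ordered pairs of
different particles `p` of `C` in `A` and `q` of `C` in `B`. -/
def Config.interaction {d : ℕ} (s : ℝ) (C : Config d) (A B : Set (Space d)) : ℝ≥0∞ :=
  ∑' p : A, ∑' q : B, (C.pairs p q : ℝ≥0∞) * riesz s (p : Space d) (q : Space d)

/-- The density of a configuration: `liminf_{R → ∞} |C ∩ K_R| / R^d`. -/
def Config.density {d : ℕ} (C : Config d) : ℝ≥0∞ :=
  liminf (fun R : ℝ => C.count (cube d R) / ENNReal.ofReal R ^ d) atTop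

/-- The set of point configurations of density `m`. -/
def configOfDensity (d : ℕ) (m : ℝ≥0∞) : Set (Config d) := {C | C.density = m}

/-- The Riesz `s`-energy of a configuration: `liminf_{R → ∞} Int[K_R, K_R](C) / R^d`. -/
def Config.energy {d : ℕ} (s : ℝ) (C : Config d) : ℝ≥0∞ :=
  liminf (fun R : ℝ => C.interaction s (cube d R) (cube d R) / ENNReal.ofReal R ^ d) atTop

/-- The Riesz energy `∑_{i ≠ j} 1 / |x_i - x_j|^s` of an `N`-tuple of points. -/
def finiteEnergy {d N : ℕ} (s : ℝ) (ω : Fin N → Space d) : ℝ≥0∞ :=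
  ∑ i, ∑ j, if i = j then 0 else riesz s (ω i) (ω j)

/-- The `N`-point minimal energy `E_s(A, N)`. -/
def minEnergy {d : ℕ} (s : ℝ) (A : Set (Space d)) (N : ℕ) : ℝ≥0∞ :=
  ⨅ (ω : Fin N → Space d) (_ : ∀ i, ω i ∈ A), finiteEnergy s ω

/-- The rescaled minimal energy `E_s(K_1, N) / N^{1 + s/d}` on the unit cube. -/
def scaledMinEnergy (d : ℕ) (s : ℝ) (N : ℕ) : ℝ≥0∞ :=
  minEnergy s (cube d 1) N / (N : ℝ≥0∞) ^ (1 + s / (d : ℝ))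

/-- The asymptotic minimal energy `C_{s,d} = lim_{N → ∞} E_s(K_1, N) / N^{1 + s/d}`. -/
def asymptoticMinEnergy (d : ℕ) (s : ℝ) : ℝ≥0∞ := limUnder atTop (scaledMinEnergy d s)

/-- `C` is `tΛ`-periodic: it is invariant under all translations by vectors `t λ`, `λ ∈ Λ`. -/
def Config.IsPeriodic {d : ℕ} (C : Config d) (t : ℝ) (Λ : Submodule ℤ (Space d)) : Prop :=
  ∀ v ∈ Λ, ∀ p : Space d, C (p + t • v) = C p

end HypersingularRiesz

end

noncomputable section

namespace HypersingularRiesz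

variable {d : ℕ}

/-! Since s > d, interactions between well separated groups of particles are negligible against the
main order N^{1+s/d}, so near-optimal configurations can be cut, rescaled and glued. Every
construction shrinks cells by a factor 1 - δ. The gaps this leaves make the interactions between
cells summable (`intSum_lt_top`, `tsum_lattice_lt_top`), at a cost that disappears as δ → 0.

Existence of the limit: filling a grid of m^d cells with copies of a good N-point configuration
bounds the limsup of the scaled energies by a quantity close to the scaled energy at N
(`limsup_scaledMinEnergy_le`); hence limsup ≤ liminf. The case N = 1 gives finiteness, and a
pigeonhole argument gives positivity.

Lower bound for configurations: a configuration of density 1 has at least about R^d points in K_R.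
Rescaling them to K_1 compares their energy with the minimal energy
(`asymptoticMinEnergy_le_energy`).

Periodic upper bound: almost all of an open fundamental domain of Λ is filled by small cubes, each
holding a near-optimal finite configuration. Periodizing gives `limsup_scaledPeriodicMinEnergy_le`,
and dilating by N^{1/d} restores density 1 (`exists_periodic_sequence`).

Attainment: the energy and the density are liminfs, so no compactness is needed. Better and better
configurations D_j are placed in cubic shells whose radii grow very fast, separated by thin empty
gaps. At the outer radius of a shell everything inside is negligible, so the energy there is nearly
that of D_j (`exists_energy_le`). -/

lemma riesz_comm (s : ℝ) (x y : Space d) : riesz s x y = riesz s y x := by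
  simp [riesz, edist_comm]

lemma riesz_add_left (s : ℝ) (c x y : Space d) : riesz s (c + x) (c + y) = riesz s x y := by
  simp [riesz]

lemma riesz_add_right (s : ℝ) (c x y : Space d) : riesz s (x + c) (y + c) = riesz s x y := by
  simp [riesz]

lemma riesz_smul (s : ℝ) {t : ℝ} (ht : 0 < t) (x y : Space d) :
    riesz s (t • x) (t • y) = ENNReal.ofReal t ^ (-s) * riesz s x y := by
  have h : edist (t • x) (t • y) = ENNReal.ofReal t * edist x y := by
    rw [edist_smul₀, ENNReal.smul_def, smul_eq_mul, ← enorm_eq_nnnorm, Real.enorm_of_nonneg ht.le]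
  rw [riesz, riesz, h]
  have h0 : ENNReal.ofReal t ≠ 0 := by simpa using ht
  -- The product rule for powers needs nonzero factors; at coinciding points both sides are 0, 1 or
  -- ∞ according to the sign of s.
  rcases eq_or_ne (edist x y) 0 with hz | hz
  · rw [hz, mul_zero]
    rcases lt_trichotomy s 0 with hs | hs | hs
    · rw [ENNReal.zero_rpow_of_pos (by linarith), mul_zero]
    · simp [hs]
    · rw [ENNReal.zero_rpow_of_neg (by linarith), ENNReal.mul_top]
      simp [ENNReal.rpow_eq_zero_iff, ht]
  · exact ENNReal.mul_rpow_of_ne_zero h0 hz _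

lemma rpow_neg_le_rpow_neg {s : ℝ} (hs : 0 ≤ s) {a b : ℝ≥0∞} (h : a ≤ b) :
    b ^ (-s) ≤ a ^ (-s) := by
  rw [ENNReal.rpow_neg, ENNReal.rpow_neg]
  exact ENNReal.inv_le_inv.2 (ENNReal.rpow_le_rpow h hs)

lemma riesz_le {s : ℝ} (hs : 0 ≤ s) {x y : Space d} {r : ℝ} (h : r ≤ ‖x - y‖) :
    riesz s x y ≤ ENNReal.ofReal r ^ (-s) := by
  refine rpow_neg_le_rpow_neg hs ?_
  rw [edist_dist, dist_eq_norm]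
  exact ENNReal.ofReal_le_ofReal h

lemma le_riesz {s : ℝ} (hs : 0 ≤ s) {x y : Space d} {r : ℝ} (h : ‖x - y‖ ≤ r) :
    ENNReal.ofReal r ^ (-s) ≤ riesz s x y := by
  refine rpow_neg_le_rpow_neg hs ?_
  rw [edist_dist, dist_eq_norm]
  exact ENNReal.ofReal_le_ofReal h

/-! ### Cubes -/

lemma mem_cube {R : ℝ} {x : Space d} : x ∈ cube d R ↔ ∀ i, |x i| ≤ R / 2 := Iff.rfl

lemma cube_mono {R R' : ℝ} (h : R ≤ R') : cube d R ⊆ cube d R' := fun _ hx i =>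
  (hx i).trans (by linarith)

lemma smul_mem_cube {t R : ℝ} (ht : 0 < t) {x : Space d} :
    t • x ∈ cube d R ↔ x ∈ cube d (R / t) := by
  simp only [mem_cube, PiLp.smul_apply, smul_eq_mul, abs_mul, abs_of_pos ht]
  refine forall_congr' fun i => ?_
  rw [div_right_comm, le_div_iff₀ ht, mul_comm]

lemma add_mem_cube {R r : ℝ} {x y : Space d} (hx : x ∈ cube d R) (hy : ‖y‖ ≤ r) :
    x + y ∈ cube d (R + 2 * r) := by
  intro i
  have h1 := hx i
  have h2 : |y i| ≤ r := (PiLp.norm_apply_le y i).trans hy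
  calc |(x + y) i| ≤ |x i| + |y i| := by simpa using abs_add_le (x i) (y i)
    _ ≤ _ := by linarith

lemma norm_le_of_mem_cube {R : ℝ} {x : Space d} (hx : x ∈ cube d R) : ‖x‖ ≤ √d * (R / 2) := by
  -- In dimension 0 the cube is the whole space even for negative R, so membership does not force 0
  -- ≤ R.
  rcases isEmpty_or_nonempty (Fin d) with h | ⟨⟨i0⟩⟩
  · have : d = 0 := Nat.eq_zero_of_not_pos fun h0 => h.false ⟨0, h0⟩
    subst this
    simp [Subsingleton.elim x 0]
  have hR : 0 ≤ R / 2 := (abs_nonneg _).trans (hx i0)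
  rw [EuclideanSpace.norm_eq, ← Real.sqrt_sq hR, ← Real.sqrt_mul (by positivity)]
  refine Real.sqrt_le_sqrt ?_
  calc ∑ i, ‖x i‖ ^ 2 ≤ ∑ _i : Fin d, (R / 2) ^ 2 :=
        Finset.sum_le_sum fun i _ => by
          have := hx i
          rw [Real.norm_eq_abs]
          gcongr
    _ = _ := by simp

lemma isBounded_cube (R : ℝ) : Bornology.IsBounded (cube d R) :=
  isBounded_iff_forall_norm_le.2 ⟨_, fun _ hx => norm_le_of_mem_cube hx⟩

lemma isClosed_cube (R : ℝ) : IsClosed (cube d R) := by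
  have : cube d R = ⋂ i, {x : Space d | |x i| ≤ R / 2} := by
    ext x; simp [mem_cube]
  rw [this]
  exact isClosed_iInter fun i => isClosed_le (by fun_prop) continuous_const

/-! ### Energies of families of points and minimal energies -/

open scoped Classical in
/-- The Riesz energy of a (possibly infinite) family of points. -/
def familyEnergy {ι : Type*} (s : ℝ) (x : ι → Space d) : ℝ≥0∞ :=
  ∑' i, ∑' j, if i = j then 0 else riesz s (x i) (x j)

lemma familyEnergy_eq_tsum {ι : Type*} [DecidableEq ι] (s : ℝ) (x : ι → Space d) :
    familyEnergy s x = ∑' i, ∑' j, if i = j then 0 else riesz s (x i) (x j) := by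
  unfold familyEnergy
  congr!

lemma finiteEnergy_eq {N : ℕ} (s : ℝ) (ω : Fin N → Space d) :
    finiteEnergy s ω = familyEnergy s ω := by
  simp only [finiteEnergy, familyEnergy, tsum_fintype]
  refine Finset.sum_congr rfl fun i _ => Finset.sum_congr rfl fun j _ => ?_
  split_ifs <;> rfl

lemma familyEnergy_comp_le {ι κ : Type*} (s : ℝ) (x : ι → Space d) {f : κ → ι}
    (hf : Function.Injective f) : familyEnergy s (x ∘ f) ≤ familyEnergy s x := by
  classical
  unfold familyEnergy
  refine le_trans ?_ (ENNReal.tsum_comp_le_tsum_of_injective hf _)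
  refine ENNReal.tsum_le_tsum fun i => ?_
  refine le_trans ?_ (ENNReal.tsum_comp_le_tsum_of_injective hf _)
  refine ENNReal.tsum_le_tsum fun j => ?_
  simp [hf.eq_iff]

lemma familyEnergy_comp_equiv {ι κ : Type*} (s : ℝ) (x : ι → Space d) (e : κ ≃ ι) :
    familyEnergy s (x ∘ e) = familyEnergy s x := by
  refine le_antisymm (familyEnergy_comp_le s x e.injective) ?_
  have := familyEnergy_comp_le s (x ∘ e) e.symm.injective
  simpa [Function.comp_assoc] using this

lemma familyEnergy_smul {ι : Type*} (s : ℝ) (x : ι → Space d) {t : ℝ} (ht : 0 < t) :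
    familyEnergy s (fun i => t • x i) = ENNReal.ofReal t ^ (-s) * familyEnergy s x := by
  classical
  unfold familyEnergy
  simp_rw [← ENNReal.tsum_mul_left, riesz_smul s ht, mul_ite, mul_zero]

lemma familyEnergy_const_add {ι : Type*} (s : ℝ) (x : ι → Space d) (c : Space d) :
    familyEnergy s (fun i => c + x i) = familyEnergy s x := by
  simp only [familyEnergy, riesz_add_left]

lemma minEnergy_le {s : ℝ} {A : Set (Space d)} {N : ℕ} {ι : Type*} {x : ι → Space d}
    (hx : ∀ i, x i ∈ A) {f : Fin N → ι} (hf : Function.Injective f) :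
    minEnergy s A N ≤ familyEnergy s x := by
  refine (iInf₂_le (x ∘ f) fun i => hx _).trans ?_
  rw [finiteEnergy_eq]
  exact familyEnergy_comp_le s x hf

/-- The slack 1 makes it unnecessary to know that minimizers exist; it is lost after division by
N^{1+s/d}. -/
lemma exists_familyEnergy_le (s : ℝ) {A : Set (Space d)} (hA : A.Nonempty) (N : ℕ) :
    ∃ ω : Fin N → Space d, (∀ i, ω i ∈ A) ∧ familyEnergy s ω ≤ minEnergy s A N + 1 := by
  rcases eq_or_ne (minEnergy s A N) ⊤ with h | h
  · obtain ⟨a, ha⟩ := hA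
    exact ⟨fun _ => a, fun _ => ha, by simp [h]⟩
  have h1 : minEnergy s A N < minEnergy s A N + 1 := ENNReal.lt_add_right h one_ne_zero
  conv_lhs at h1 => rw [minEnergy]
  simp only [iInf_lt_iff] at h1
  obtain ⟨ω, hω, h1⟩ := h1
  exact ⟨ω, hω, by rw [← finiteEnergy_eq]; exact h1.le⟩

lemma minEnergy_mono (s : ℝ) (A : Set (Space d)) {M N : ℕ} (h : M ≤ N) :
    minEnergy s A M ≤ minEnergy s A N := by
  refine le_iInf₂ fun ω hω => ?_
  rw [finiteEnergy_eq]
  exact minEnergy_le hω (Fin.castLE_injective h)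

lemma zero_mem_cube {R : ℝ} (hR : 0 ≤ R) : (0 : Space d) ∈ cube d R := fun i => by
  simpa using by linarith

lemma minEnergy_cube_one_le {s R : ℝ} (hR : 0 < R) {N : ℕ} {ω : Fin N → Space d}
    (hω : ∀ i, ω i ∈ cube d R) :
    ENNReal.ofReal R ^ (-s) * minEnergy s (cube d 1) N ≤ familyEnergy s ω := by
  have h : minEnergy s (cube d 1) N ≤ familyEnergy s fun i => R⁻¹ • ω i := by
    refine minEnergy_le (f := id) (fun i => ?_) Function.injective_id
    rw [smul_mem_cube (inv_pos.2 hR)]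
    simpa using hω i
  calc _ ≤ ENNReal.ofReal R ^ (-s) * familyEnergy s fun i => R⁻¹ • ω i := by gcongr
    _ = familyEnergy s fun i => R • R⁻¹ • ω i := (familyEnergy_smul s _ hR).symm
    _ = _ := by simp [smul_smul, hR.ne']

/-! ### Lattice sums and interactions between separated cells -/

/-- This is one of the places where s > d is essential: |v|^{-s} is summable over a lattice of rank
d. -/
lemma tsum_lattice_lt_top {E : Type*} [NormedAddCommGroup E] [NormedSpace ℝ E]
    [FiniteDimensional ℝ E] (L : Submodule ℤ E) [DiscreteTopology L] [IsZLattice ℝ L]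
    [DecidableEq L] {s : ℝ} (hs : (Module.finrank ℝ E : ℝ) < s) :
    ∑' v : L, (if v = 0 then 0 else ENNReal.ofReal ‖v‖ ^ (-s)) < ⊤ := by
  have h : Summable fun v : L => ‖v‖ ^ (-s) :=
    ZLattice.summable_norm_rpow L (-s) (by rw [ZLattice.rank ℝ L]; linarith)
  refine lt_of_le_of_lt (ENNReal.tsum_le_tsum fun v => ?_) h.tsum_ofReal_lt_top
  split_ifs with hv
  · simp
  · rw [ENNReal.ofReal_rpow_of_pos (norm_pos_iff.2 hv)]

open scoped Classical in
/-- The sum of `1 / |k|^s` over the nonzero integer vectors, for the sup norm. -/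
def intSum (d : ℕ) (s : ℝ) : ℝ≥0∞ :=
  ∑' k : Fin d → ℤ, if k = 0 then 0 else ENNReal.ofReal ‖k‖ ^ (-s)

/-- The integer vectors embed isometrically, for the sup norm, in the ℤ-span of the standard basis,
to which the lattice bound applies. -/
lemma intSum_lt_top {s : ℝ} (hs : (d : ℝ) < s) : intSum d s < ⊤ := by
  classical
  let L := Submodule.span ℤ (Set.range (Pi.basisFun ℝ (Fin d)))
  have hL := tsum_lattice_lt_top L (s := s) (by simpa using hs)
  have hmem : ∀ k : Fin d → ℤ, (fun i => (k i : ℝ)) ∈ L := fun k => by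
    have : (fun i => (k i : ℝ)) = ∑ i, k i • Pi.basisFun ℝ (Fin d) i := by
      ext j; simp [Finset.sum_apply, Pi.single_apply]
    rw [this]
    exact Submodule.sum_mem _ fun i _ =>
      Submodule.smul_mem _ _ (Submodule.subset_span ⟨i, rfl⟩)
  have hinj : Function.Injective fun k : Fin d → ℤ => (⟨_, hmem k⟩ : L) := by
    intro k k' h
    ext i
    have : (k i : ℝ) = k' i := congrFun (congrArg Subtype.val h) i
    exact_mod_cast this
  refine lt_of_le_of_lt ?_ hL
  refine le_trans ?_ (ENNReal.tsum_comp_le_tsum_of_injective hinj _)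
  refine ENNReal.tsum_le_tsum fun k => ?_
  have h0 : ((⟨_, hmem k⟩ : L) = 0) ↔ k = 0 := by
    rw [← Subtype.coe_inj]
    simp [funext_iff]
  have hn : ‖(⟨_, hmem k⟩ : L)‖ = ‖k‖ := by
    rw [Submodule.coe_norm]
    refine le_antisymm ((pi_norm_le_iff_of_nonneg (norm_nonneg _)).2 fun i => ?_)
      ((pi_norm_le_iff_of_nonneg (norm_nonneg _)).2 fun i => ?_)
    · simpa [Int.norm_eq_abs] using norm_le_pi_norm k i
    · simpa [Int.norm_eq_abs] using norm_le_pi_norm (fun i => (k i : ℝ)) i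
  simp only [h0, hn, le_refl]

/-- Each cell contributes its own energy, and each ordered pair of distinct cells contributes n²
interactions, each controlled by the weight w of that pair. -/
lemma familyEnergy_cells_le {κ : Type*} [Fintype κ] {n : ℕ} {s : ℝ} (x : κ × Fin n → Space d)
    {e S : ℝ≥0∞} {w : κ → κ → ℝ≥0∞} (he : ∀ k, familyEnergy s (fun a => x (k, a)) ≤ e)
    (hw : ∀ k k' a b, k ≠ k' → riesz s (x (k, a)) (x (k', b)) ≤ w k k')
    (hS : ∀ k, ∑' k', w k k' ≤ S) :
    familyEnergy s x ≤ Fintype.card κ * (e + n * n * S) := by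
  classical
  have key : ∀ k, ∑' a, ∑' q : κ × Fin n,
      (if (k, a) = q then 0 else riesz s (x (k, a)) (x q)) ≤ e + n * n * S := by
    intro k
    -- The weight is also added on the diagonal k = k', which only loosens the bound but lets the
    -- sum over k' be a full row of w.
    calc _ ≤ ∑' a : Fin n, ∑' k', ∑' b : Fin n, ((if k = k' then
            (if a = b then 0 else riesz s (x (k, a)) (x (k, b))) else 0) + w k k') := by
          refine ENNReal.tsum_le_tsum fun a => ?_
          rw [ENNReal.tsum_prod']
          refine ENNReal.tsum_le_tsum fun k' => ENNReal.tsum_le_tsum fun b => ?_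
          by_cases hk : k = k'
          · subst hk
            simp only [Prod.mk.injEq, true_and, if_true]
            exact le_self_add
          · simpa [hk] using hw k k' a b hk
      _ ≤ ∑' a : Fin n, ((∑' b : Fin n, if a = b then 0 else riesz s (x (k, a)) (x (k, b))) +
            n * S) := by
          refine ENNReal.tsum_le_tsum fun a => ?_
          simp_rw [ENNReal.tsum_add]
          refine add_le_add (le_of_eq ?_) ?_
          · rw [tsum_eq_single k fun k' hk' => by simp [Ne.symm hk']]
            simp
          · simp only [tsum_fintype (L := .unconditional (Fin n)), Finset.sum_const,
              Finset.card_univ, Fintype.card_fin, nsmul_eq_mul]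
            rw [ENNReal.tsum_mul_left]
            gcongr
            exact hS k
      _ ≤ _ := by
          rw [ENNReal.tsum_add]
          refine add_le_add ((familyEnergy_eq_tsum s _).symm.trans_le (he k)) (le_of_eq ?_)
          simp [mul_assoc]
  calc familyEnergy s x = ∑' k, ∑' a, ∑' q : κ × Fin n,
      (if (k, a) = q then 0 else riesz s (x (k, a)) (x q)) := by
        rw [familyEnergy_eq_tsum, ENNReal.tsum_prod']
    _ ≤ ∑' _k : κ, (e + n * n * S) := ENNReal.tsum_le_tsum key
    _ = _ := by simp [mul_add]

/-- The point with coordinates `k i`. -/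
def intPoint (k : Fin d → ℤ) : Space d := WithLp.toLp 2 fun i => (k i : ℝ)

@[simp] lemma intPoint_apply (k : Fin d → ℤ) (i : Fin d) : intPoint k i = k i := rfl

/-- Points of distinct cells of a grid, each cell being shrunk by the factor `1 - δ`, are well
separated. -/
lemma norm_sub_ge_of_cells {h δ : ℝ} (hh : 0 ≤ h) (hδ : δ ≤ 1) {x y : Space d}
    (hx : x ∈ cube d ((1 - δ) * h)) (hy : y ∈ cube d ((1 - δ) * h)) (k k' : Fin d → ℤ)
    (hk : k ≠ k') :
    δ * h * ‖k - k'‖ ≤ ‖(h • intPoint k + x) - (h • intPoint k' + y)‖ := by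
  have hne : Nonempty (Fin d) := by
    by_contra h0
    rw [not_nonempty_iff] at h0
    exact hk (Subsingleton.elim _ _)
  obtain ⟨i, hi⟩ := Finite.exists_max fun i => ‖(k - k') i‖
  have hki : ‖k - k'‖ = |(k i : ℝ) - k' i| := by
    refine le_antisymm ((pi_norm_le_iff_of_nonneg (abs_nonneg _)).2 fun j => ?_) ?_
    · simpa [Int.norm_eq_abs] using hi j
    · simpa [Int.norm_eq_abs] using norm_le_pi_norm (k - k') i
  have h1 : 1 ≤ |(k i : ℝ) - k' i| := by
    rw [← hki]
    obtain ⟨j, hj⟩ := Function.ne_iff.1 hk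
    refine le_trans ?_ (norm_le_pi_norm (k - k') j)
    rw [Pi.sub_apply, Int.norm_eq_abs]
    exact_mod_cast Int.one_le_abs (sub_ne_zero.2 hj)
  refine le_trans ?_ (PiLp.norm_apply_le _ i)
  have e1 : ((h • intPoint k + x) - (h • intPoint k' + y)) i =
      h * ((k i : ℝ) - k' i) - (y i - x i) := by
    simp; ring
  rw [e1, hki, Real.norm_eq_abs]
  have h2 := abs_sub_abs_le_abs_sub (h * ((k i : ℝ) - k' i)) (y i - x i)
  rw [abs_mul, abs_of_nonneg hh] at h2
  have h3 : |y i - x i| ≤ (1 - δ) * h :=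
    (abs_sub _ _).trans (by linarith [hx i, hy i])
  -- With M = ‖k - k'‖ ≥ 1 the distance is at least hM - (1 - δ)h, which exceeds δhM by (1 - δ)h(M -
  -- 1) ≥ 0.
  nlinarith [mul_nonneg (mul_nonneg hh (sub_nonneg.2 hδ)) (sub_nonneg.2 h1)]

lemma tsum_cells_le {h δ s : ℝ} (hh : 0 < h) (hδ : 0 < δ) {κ : Type*} {c : κ → Fin d → ℤ}
    (hc : Function.Injective c) (k : Fin d → ℤ) :
    ∑' k', (if k = c k' then 0 else ENNReal.ofReal (δ * h * ‖k - c k'‖) ^ (-s)) ≤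
      ENNReal.ofReal (δ * h) ^ (-s) * intSum d s := by
  classical
  refine (ENNReal.tsum_comp_le_tsum_of_injective hc (fun k' => if k = k' then 0 else
    ENNReal.ofReal (δ * h * ‖k - k'‖) ^ (-s))).trans ?_
  rw [intSum, ← ENNReal.tsum_mul_left, ← (Equiv.subLeft k).tsum_eq]
  refine ENNReal.tsum_le_tsum fun k' => ?_
  rcases eq_or_ne k' 0 with h0 | h0
  · simp [h0]
  have : 0 < ‖k'‖ := norm_pos_iff.2 h0
  simp only [Equiv.subLeft_apply, sub_sub_cancel, h0, if_false]
  rw [ENNReal.ofReal_mul (by positivity), ENNReal.mul_rpow_of_ne_zero (by simp; positivity)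
    (by simpa using this)]
  split_ifs <;> simp

/-! ### Subdivision of the cube and existence of the limit -/

/-- The unit cube is cut into m^d cells of side 1/m, and each receives a copy of a near-optimal
N-point configuration, shrunk by (1 - δ)/m. -/
lemma minEnergy_mul_pow_le {s : ℝ} (hs : 0 ≤ s) (N : ℕ) {m : ℕ} (hm : 0 < m) {δ : ℝ}
    (hδ : 0 < δ) (hδ1 : δ < 1) :
    minEnergy s (cube d 1) (N * m ^ d) ≤
      (m : ℝ≥0∞) ^ d * (ENNReal.ofReal ((1 - δ) * (m : ℝ)⁻¹) ^ (-s) *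
        (minEnergy s (cube d 1) N + 1) +
        N * N * (ENNReal.ofReal (δ * (m : ℝ)⁻¹) ^ (-s) * intSum d s)) := by
  classical
  obtain ⟨ω, hω, hE⟩ := exists_familyEnergy_le s ⟨0, zero_mem_cube zero_le_one⟩ (A := cube d 1) N
  have hm' : (0 : ℝ) < m := by exact_mod_cast hm
  set h : ℝ := (m : ℝ)⁻¹ with hdef
  have hh : 0 < h := by positivity
  have ht : 0 < (1 - δ) * h := mul_pos (by linarith) hh
  let c : (Fin d → Fin m) → Fin d → ℤ := fun k i => (k i : ℕ)
  have hc : Function.Injective c := fun k k' hk => by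
    ext i
    have := congrFun hk i
    simpa [c] using this
  -- Cell indices run over {0, …, m - 1}^d, so this shift centres the grid at the origin.
  let v : Space d := WithLp.toLp 2 fun _ => h / 2 - 1 / 2
  let x : (Fin d → Fin m) × Fin N → Space d := fun q =>
    v + (h • intPoint (c q.1) + ((1 - δ) * h) • ω q.2)
  have hmem : ∀ a, ((1 - δ) * h) • ω a ∈ cube d ((1 - δ) * h) := fun a => by
    rw [smul_mem_cube ht, div_self ht.ne']
    exact hω a
  have hx : ∀ q, x q ∈ cube d 1 := by
    rintro ⟨k, a⟩ i
    have h1 := abs_le.1 (hmem a i)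
    have e : x (k, a) i = h / 2 - 1 / 2 + (h * (k i : ℕ) + (((1 - δ) * h) • ω a) i) := by
      simp [x, v, c]
    have h2 : (0 : ℝ) ≤ h * (k i : ℕ) := by positivity
    have h3 : h * (k i : ℕ) ≤ 1 - h := by
      have : ((k i : ℕ) : ℝ) + 1 ≤ m := by exact_mod_cast (k i).2
      have h4 : h * m = 1 := inv_mul_cancel₀ hm'.ne'
      nlinarith
    rw [e, abs_le]
    constructor <;> nlinarith [mul_pos hδ hh]
  have hcard : Fintype.card ((Fin d → Fin m) × Fin N) = N * m ^ d := by
    simp [mul_comm]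
  have h1 := minEnergy_le (s := s) hx
    (f := (Fintype.equivFinOfCardEq hcard).symm) (Equiv.injective _)
  refine h1.trans ((familyEnergy_cells_le x (w := fun k k' => if c k = c k' then 0 else
    ENNReal.ofReal (δ * h * ‖c k - c k'‖) ^ (-s)) (e := ENNReal.ofReal ((1 - δ) * h) ^ (-s) *
        (minEnergy s (cube d 1) N + 1)) (fun k => ?_) (fun k k' a b hk => ?_)
    fun k => tsum_cells_le hh hδ hc (c k)).trans ?_)
  · simp only [x]
    rw [familyEnergy_const_add, familyEnergy_const_add, familyEnergy_smul s _ ht]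
    gcongr
  · have hk' : c k ≠ c k' := hc.ne hk
    simp only [hk', if_false, x]
    rw [riesz_add_left]
    exact riesz_le hs (norm_sub_ge_of_cells hh.le hδ1.le (hmem a) (hmem b) _ _ hk')
  · simp

lemma natCast_rpow_ne_zero {n : ℕ} (hn : 0 < n) (p : ℝ) : (n : ℝ≥0∞) ^ p ≠ 0 := by
  have h : (n : ℝ≥0∞) ≠ 0 := by exact_mod_cast hn.ne'
  simp [ENNReal.rpow_eq_zero_iff, h]

lemma natCast_rpow_ne_top {n : ℕ} (hn : 0 < n) (p : ℝ) : (n : ℝ≥0∞) ^ p ≠ ⊤ := by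
  have h : (n : ℝ≥0∞) ≠ 0 := by exact_mod_cast hn.ne'
  simp [ENNReal.rpow_eq_top_iff, h]

lemma natCast_pow_mul_rpow (hd : 0 < d) {m : ℕ} (hm : 0 < m) (s : ℝ) :
    (m : ℝ≥0∞) ^ d * (m : ℝ≥0∞) ^ s = ((m : ℝ≥0∞) ^ d) ^ (1 + s / (d : ℝ)) := by
  have hme : (m : ℝ≥0∞) ≠ 0 := by exact_mod_cast hm.ne'
  rw [← ENNReal.rpow_natCast, ← ENNReal.rpow_mul, ← ENNReal.rpow_add _ _ hme (by simp)]
  congr 1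
  field_simp

lemma ofReal_div_natCast_rpow_neg {t : ℝ} (ht : 0 < t) {m : ℕ} (hm : 0 < m) (s : ℝ) :
    ENNReal.ofReal (t / m) ^ (-s) = ENNReal.ofReal t ^ (-s) * (m : ℝ≥0∞) ^ s := by
  have hm' : (0 : ℝ) < m := by exact_mod_cast hm
  rw [div_eq_mul_inv, ENNReal.ofReal_mul ht.le, ENNReal.ofReal_inv_of_pos hm',
    ENNReal.ofReal_natCast, ENNReal.mul_rpow_of_ne_zero (by simpa using ht) (by simp),
    ENNReal.inv_rpow, ← ENNReal.rpow_neg, neg_neg]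

lemma minEnergy_eq_mul {s : ℝ} {N : ℕ} (hN : 0 < N) :
    minEnergy s (cube d 1) N = scaledMinEnergy d s N * (N : ℝ≥0∞) ^ (1 + s / (d : ℝ)) := by
  rw [scaledMinEnergy, ENNReal.div_mul_cancel (natCast_rpow_ne_zero hN _)
    (natCast_rpow_ne_top hN _)]

/-- The upper bound for the scaled minimal energy obtained by subdividing the cube into smaller
cubes with `N` points each. -/
def subdivisionBound (d : ℕ) (s δ : ℝ) (N : ℕ) : ℝ≥0∞ :=
  ENNReal.ofReal (1 - δ) ^ (-s) * (scaledMinEnergy d s N + 1 / (N : ℝ≥0∞) ^ (1 + s / (d : ℝ))) +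
    ENNReal.ofReal δ ^ (-s) * intSum d s * (N * N / (N : ℝ≥0∞) ^ (1 + s / (d : ℝ)))

/-- All terms scale in m like m^d · m^s = (m^d)^{1+s/d}, so after normalization the bound no longer
depends on m. -/
lemma minEnergy_mul_pow_le_subdivisionBound (hd : 0 < d) {s : ℝ} (hs : 0 ≤ s) {N : ℕ} (hN : 0 < N)
    {m : ℕ} (hm : 0 < m) {δ : ℝ} (hδ : 0 < δ) (hδ1 : δ < 1) :
    minEnergy s (cube d 1) (N * m ^ d) ≤
      subdivisionBound d s δ N * ((N * m ^ d : ℕ) : ℝ≥0∞) ^ (1 + s / (d : ℝ)) := by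
  refine (minEnergy_mul_pow_le hs N hm hδ hδ1).trans (le_of_eq ?_)
  have hp : 0 ≤ 1 + s / (d : ℝ) := by positivity
  have h1 : ∀ t : ℝ, 0 < t → ENNReal.ofReal (t * (m : ℝ)⁻¹) ^ (-s) =
      ENNReal.ofReal t ^ (-s) * (m : ℝ≥0∞) ^ s := fun t ht => by
    rw [← div_eq_mul_inv, ofReal_div_natCast_rpow_neg ht hm]
  have h2 := natCast_pow_mul_rpow hd hm s
  have h3 : ((N * m ^ d : ℕ) : ℝ≥0∞) ^ (1 + s / (d : ℝ)) =
      (N : ℝ≥0∞) ^ (1 + s / (d : ℝ)) * ((m : ℝ≥0∞) ^ d * (m : ℝ≥0∞) ^ s) := by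
    rw [h2]
    push_cast
    rw [ENNReal.mul_rpow_of_nonneg _ _ hp]
  set P := (N : ℝ≥0∞) ^ (1 + s / (d : ℝ)) with hP
  have hP0 : P ≠ 0 := natCast_rpow_ne_zero hN _
  have hPt : P ≠ ⊤ := natCast_rpow_ne_top hN _
  rw [h1 _ (by linarith), h1 _ hδ, h3, subdivisionBound, ← hP, minEnergy_eq_mul hN, ← hP]
  have h4 : (1 / P) * P = 1 := ENNReal.div_mul_cancel hP0 hPt
  have h5 : ((N : ℝ≥0∞) * N / P) * P = N * N := ENNReal.div_mul_cancel hP0 hPt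
  calc _ = (ENNReal.ofReal (1 - δ) ^ (-s) * (scaledMinEnergy d s N * P + 1 / P * P) +
    ENNReal.ofReal δ ^ (-s) * intSum d s * ((N : ℝ≥0∞) * N / P * P)) *
      ((m : ℝ≥0∞) ^ d * (m : ℝ≥0∞) ^ s) := by rw [h4, h5]; ring
    _ = _ := by ring

/-- A general number M of points is rounded up to N m^d with m = ⌈(M/N)^{1/d}⌉, using monotonicity
in the number of points. The last factor bounds the rounding loss and tends to 1 as M → ∞. -/
lemma scaledMinEnergy_le (hd : 0 < d) {s : ℝ} (hs : 0 ≤ s) {N M : ℕ} (hN : 0 < N) (hM : 0 < M)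
    {δ : ℝ} (hδ : 0 < δ) (hδ1 : δ < 1) :
    scaledMinEnergy d s M ≤ subdivisionBound d s δ N *
      ENNReal.ofReal ((1 + ((N : ℝ) / M) ^ (1 / (d : ℝ))) ^ (d : ℝ)) ^ (1 + s / (d : ℝ)) := by
  have hN' : (0 : ℝ) < N := by exact_mod_cast hN
  have hM' : (0 : ℝ) < M := by exact_mod_cast hM
  have hd' : (d : ℝ) ≠ 0 := by exact_mod_cast hd.ne'
  have hp : 0 ≤ 1 + s / (d : ℝ) := by positivity
  set q : ℝ := ((M : ℝ) / N) ^ (1 / (d : ℝ)) with hq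
  have hq0 : 0 < q := by positivity
  have hqd : q ^ (d : ℝ) = M / N := by
    rw [hq, ← Real.rpow_mul (by positivity), one_div, inv_mul_cancel₀ hd', Real.rpow_one]
  set m := ⌈q⌉₊ with hm
  have hm0 : 0 < m := Nat.ceil_pos.2 hq0
  have hle : (M : ℝ) ≤ N * (m : ℝ) ^ d := by
    have : q ^ d ≤ (m : ℝ) ^ d := by gcongr; exact Nat.le_ceil q
    rw [← Real.rpow_natCast, hqd, div_le_iff₀ hN'] at this
    linarith
  have hle' : M ≤ N * m ^ d := by exact_mod_cast hle
  have hge : (N : ℝ) * (m : ℝ) ^ d ≤ (1 + ((N : ℝ) / M) ^ (1 / (d : ℝ))) ^ (d : ℝ) * M := by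
    have h1 : (m : ℝ) ≤ q * (1 + ((N : ℝ) / M) ^ (1 / (d : ℝ))) := by
      have h2 : q * ((N : ℝ) / M) ^ (1 / (d : ℝ)) = 1 := by
        rw [hq, ← Real.mul_rpow (by positivity) (by positivity), div_mul_div_comm,
          mul_comm, div_self (by positivity), Real.one_rpow]
      rw [mul_add, h2, mul_one]
      exact (Nat.ceil_lt_add_one hq0.le).le
    calc (N : ℝ) * (m : ℝ) ^ d ≤ N * (q * (1 + ((N : ℝ) / M) ^ (1 / (d : ℝ)))) ^ d := by gcongr
      _ = N * (q ^ (d : ℝ) * (1 + ((N : ℝ) / M) ^ (1 / (d : ℝ))) ^ (d : ℝ)) := by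
          rw [mul_pow, Real.rpow_natCast, Real.rpow_natCast]
      _ = _ := by rw [hqd]; field_simp
  rw [scaledMinEnergy, ENNReal.div_le_iff (natCast_rpow_ne_zero hM _) (natCast_rpow_ne_top hM _)]
  refine (minEnergy_mono s _ hle').trans
    ((minEnergy_mul_pow_le_subdivisionBound hd hs hN hm0 hδ hδ1).trans ?_)
  rw [mul_assoc, ← ENNReal.mul_rpow_of_nonneg _ _ hp]
  gcongr
  rw [← ENNReal.ofReal_natCast, ← ENNReal.ofReal_natCast, ← ENNReal.ofReal_mul (by positivity)]
  refine ENNReal.ofReal_le_ofReal ?_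
  push_cast
  exact hge

lemma limsup_scaledMinEnergy_le (hd : 0 < d) {s : ℝ} (hs : 0 ≤ s) {N : ℕ} (hN : 0 < N)
    {δ : ℝ} (hδ : 0 < δ) (hδ1 : δ < 1) :
    limsup (scaledMinEnergy d s) atTop ≤ subdivisionBound d s δ N := by
  have hd' : (0 : ℝ) < d := by exact_mod_cast hd
  have h1 : Tendsto (fun M : ℕ => (1 + ((N : ℝ) / M) ^ (1 / (d : ℝ))) ^ (d : ℝ)) atTop (𝓝 1) := by
    have h2 : Tendsto (fun M : ℕ => (N : ℝ) / M) atTop (𝓝 0) :=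
      tendsto_const_nhds.div_atTop tendsto_natCast_atTop_atTop
    have h3 := h2.rpow_const (p := 1 / (d : ℝ)) (Or.inr (by positivity))
    rw [Real.zero_rpow (by positivity)] at h3
    have h4 := (h3.const_add 1).rpow_const (p := (d : ℝ)) (Or.inr hd'.le)
    simpa using h4
  have h2 : Tendsto (fun M : ℕ => subdivisionBound d s δ N *
      ENNReal.ofReal ((1 + ((N : ℝ) / M) ^ (1 / (d : ℝ))) ^ (d : ℝ)) ^ (1 + s / (d : ℝ))) atTop
      (𝓝 (subdivisionBound d s δ N)) := by
    have h3 := ((ENNReal.continuous_rpow_const (y := 1 + s / (d : ℝ))).tendsto _).comp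
      (ENNReal.tendsto_ofReal h1)
    have h4 := ENNReal.Tendsto.const_mul (a := subdivisionBound d s δ N) h3
      (Or.inl (by simp))
    simpa using h4
  rw [← h2.limsup_eq]
  refine limsup_le_limsup ?_
  filter_upwards [eventually_gt_atTop 0] with M hM
  exact scaledMinEnergy_le hd hs hN hM hδ hδ1

lemma tendsto_natCast_rpow_neg {p : ℝ} (hp : 0 < p) :
    Tendsto (fun N : ℕ => (N : ℝ≥0∞) ^ (-p)) atTop (𝓝 0) := by
  have h := (ENNReal.tendsto_rpow_at_top hp).comp ENNReal.tendsto_nat_nhds_top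
  have := tendsto_inv_iff.2 h
  simpa [Function.comp_def, ENNReal.rpow_neg] using this

lemma tendsto_one_div_rpow {s : ℝ} (hs : 0 ≤ s) :
    Tendsto (fun N : ℕ => 1 / (N : ℝ≥0∞) ^ (1 + s / (d : ℝ))) atTop (𝓝 0) := by
  simp_rw [one_div, ← ENNReal.rpow_neg]
  exact tendsto_natCast_rpow_neg (by positivity)

/-- The quotient is N^{1-s/d}: as s > d, the N² interactions between any two cells are of lower
order than the energy. -/
lemma tendsto_mul_self_div_rpow (hd : 0 < d) {s : ℝ} (hs : (d : ℝ) < s) :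
    Tendsto (fun N : ℕ => (N * N : ℝ≥0∞) / (N : ℝ≥0∞) ^ (1 + s / (d : ℝ))) atTop (𝓝 0) := by
  have hd' : (0 : ℝ) < d := by exact_mod_cast hd
  have h1 : 0 < s / d - 1 := by rw [sub_pos, lt_div_iff₀ hd']; linarith
  refine (tendsto_natCast_rpow_neg h1).congr' ?_
  filter_upwards [eventually_gt_atTop 0] with N hN
  have hN' : (N : ℝ≥0∞) ≠ 0 := by exact_mod_cast hN.ne'
  rw [div_eq_mul_inv (N * N : ℝ≥0∞), ← ENNReal.rpow_neg]
  have : (N : ℝ≥0∞) * N = (N : ℝ≥0∞) ^ (2 : ℝ) := by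
    rw [ENNReal.rpow_two, sq]
  rw [this, ← ENNReal.rpow_add _ _ hN' (by simp)]
  congr 1
  ring

lemma le_const_mul_liminf_of_le {l c : ℝ≥0∞} {u v : ℕ → ℝ≥0∞} (hc0 : c ≠ 0) (hc : c ≠ ⊤)
    (hv : Tendsto v atTop (𝓝 0)) (h : ∀ᶠ n in atTop, l ≤ c * u n + v n) :
    l ≤ c * liminf u atTop := by
  refine ENNReal.le_of_forall_pos_le_add fun ε hε _ => ?_
  have h1 : ∀ᶠ n in atTop, v n ≤ ε :=
    (hv.eventually (gt_mem_nhds (by exact_mod_cast hε))).mono fun n hn => le_of_lt hn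
  have h2 : (l - ε) / c ≤ liminf u atTop := by
    refine le_liminf_of_le (by isBoundedDefault) ?_
    filter_upwards [h, h1] with n hn hn'
    refine ENNReal.div_le_of_le_mul ?_
    rw [tsub_le_iff_right, mul_comm]
    exact hn.trans (by gcongr)
  rw [ENNReal.div_le_iff hc0 hc, tsub_le_iff_right, mul_comm] at h2
  exact h2

/-- For fixed δ both error terms of `subdivisionBound` vanish as N → ∞, leaving only the factor (1 -
δ)^{-s}; then δ → 0. -/
theorem limsup_le_liminf_scaledMinEnergy (hd : 0 < d) {s : ℝ} (hs : (d : ℝ) < s) :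
    limsup (scaledMinEnergy d s) atTop ≤ liminf (scaledMinEnergy d s) atTop := by
  have hd' : (0 : ℝ) < d := by exact_mod_cast hd
  have hs0 : 0 < s := hd'.trans hs
  have key : ∀ δ : ℝ, 0 < δ → δ < 1 → limsup (scaledMinEnergy d s) atTop ≤
      ENNReal.ofReal (1 - δ) ^ (-s) * liminf (scaledMinEnergy d s) atTop := by
    intro δ hδ hδ1
    have e1 : ENNReal.ofReal (1 - δ) ≠ 0 := by simpa using hδ1
    have e2 : ENNReal.ofReal (1 - δ) ^ (-s) ≠ ⊤ := by
      simp [ENNReal.rpow_eq_top_iff, hδ1]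
    have e3 : ENNReal.ofReal δ ^ (-s) ≠ ⊤ := by
      simp [ENNReal.rpow_eq_top_iff, hδ]
    refine le_const_mul_liminf_of_le (v := fun N =>
      ENNReal.ofReal (1 - δ) ^ (-s) * (1 / (N : ℝ≥0∞) ^ (1 + s / (d : ℝ))) +
      ENNReal.ofReal δ ^ (-s) * intSum d s * (N * N / (N : ℝ≥0∞) ^ (1 + s / (d : ℝ)))) ?_ e2 ?_ ?_
    · simp [ENNReal.rpow_eq_zero_iff, hδ1]
    · have h1 := ENNReal.Tendsto.const_mul (a := ENNReal.ofReal (1 - δ) ^ (-s))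
        (tendsto_one_div_rpow (d := d) hs0.le) (Or.inr e2)
      have h2 := ENNReal.Tendsto.const_mul (a := ENNReal.ofReal δ ^ (-s) * intSum d s)
        (tendsto_mul_self_div_rpow hd hs) (Or.inr (ENNReal.mul_ne_top e3 (intSum_lt_top hs).ne))
      simpa using h1.add h2
    · filter_upwards [eventually_gt_atTop 0] with N hN
      refine (limsup_scaledMinEnergy_le hd hs0.le hN hδ hδ1).trans (le_of_eq ?_)
      rw [subdivisionBound]; ring
  have hlim : Tendsto (fun δ : ℝ => ENNReal.ofReal (1 - δ) ^ (-s) *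
      liminf (scaledMinEnergy d s) atTop) (𝓝[>] 0)
      (𝓝 (liminf (scaledMinEnergy d s) atTop)) := by
    have h1 : Tendsto (fun δ : ℝ => 1 - δ) (𝓝[>] 0) (𝓝 1) := by
      have : Tendsto (fun δ : ℝ => 1 - δ) (𝓝 0) (𝓝 (1 - 0)) := tendsto_id.const_sub 1
      rw [sub_zero] at this
      exact this.mono_left nhdsWithin_le_nhds
    have h3 := ((ENNReal.continuous_rpow_const (y := -s)).tendsto _).comp
      (ENNReal.tendsto_ofReal h1)
    have h4 := ENNReal.Tendsto.mul_const (b := liminf (scaledMinEnergy d s) atTop) h3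
      (Or.inl (by simp))
    simpa using h4
  refine ge_of_tendsto hlim ?_
  filter_upwards [Ioo_mem_nhdsGT (zero_lt_one (α := ℝ))] with δ hδ
  exact key δ hδ.1 hδ.2

theorem tendsto_scaledMinEnergy (hd : 0 < d) {s : ℝ} (hs : (d : ℝ) < s) :
    Tendsto (scaledMinEnergy d s) atTop (𝓝 (asymptoticMinEnergy d s)) := by
  have h := tendsto_of_le_liminf_of_limsup_le (le_refl (liminf (scaledMinEnergy d s) atTop))
    (limsup_le_liminf_scaledMinEnergy hd hs)
  rw [asymptoticMinEnergy, h.limUnder_eq]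
  exact h

/-! ### Finiteness and positivity of the constant -/

lemma minEnergy_one (s : ℝ) {A : Set (Space d)} (hA : A.Nonempty) : minEnergy s A 1 = 0 := by
  obtain ⟨a, ha⟩ := hA
  refine le_antisymm ((iInf₂_le (fun _ => a) fun _ => ha).trans ?_) zero_le
  simp [finiteEnergy]

/-- One point per cell suffices: with N = 1 and δ = 1/2 the subdivision bound is finite, since a
single point has no energy. -/
theorem asymptoticMinEnergy_lt_top (hd : 0 < d) {s : ℝ} (hs : (d : ℝ) < s) :
    asymptoticMinEnergy d s < ⊤ := by
  have hs0 : 0 < s := lt_of_le_of_lt (by positivity) hs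
  rw [← (tendsto_scaledMinEnergy hd hs).limsup_eq]
  refine (limsup_scaledMinEnergy_le hd hs0.le one_pos (δ := 1 / 2) (by norm_num)
    (by norm_num)).trans_lt ?_
  have e : ENNReal.ofReal (1 / 2) ^ (-s) ≠ ⊤ := by
    simp [ENNReal.rpow_eq_top_iff]
  have e' : ENNReal.ofReal (1 - 1 / 2) ^ (-s) ≠ ⊤ := by
    norm_num [ENNReal.rpow_eq_top_iff]
  rw [subdivisionBound, scaledMinEnergy, minEnergy_one s ⟨0, zero_mem_cube zero_le_one⟩]
  simp only [Nat.cast_one, ENNReal.one_rpow, zero_add, div_one, mul_one]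
  exact ENNReal.add_lt_top.2 ⟨e'.lt_top, ENNReal.mul_lt_top e.lt_top (intSum_lt_top hs)⟩

/-- Pigeonhole: among 2m^d points in m^d cells of side 1/m, at most m^d are alone in their cell.
Each of the others has a companion within the cell diameter √d/m. -/
lemma le_minEnergy_two_mul_pow {s : ℝ} (hs : 0 ≤ s) {m : ℕ} (hm : 0 < m) :
    (m : ℝ≥0∞) ^ d * ENNReal.ofReal (√d / m) ^ (-s) ≤ minEnergy s (cube d 1) (2 * m ^ d) := by
  classical
  refine le_iInf₂ fun ω hω => ?_
  have hm' : (0 : ℝ) < m := by exact_mod_cast hm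
  let c : Fin (2 * m ^ d) → Fin d → Fin m := fun i k =>
    -- The floor equals m on the face ω i k = 1/2; the minimum sends such points to the last cell.
    ⟨min ⌊m * (ω i k + 1 / 2)⌋₊ (m - 1), by omega⟩
  have hclose : ∀ i j, c i = c j → ‖ω i - ω j‖ ≤ √d / m := by
    intro i j hij
    have : ω i - ω j ∈ cube d (2 / m) := by
      intro k
      have hk : min ⌊m * (ω i k + 1 / 2)⌋₊ (m - 1) = min ⌊m * (ω j k + 1 / 2)⌋₊ (m - 1) :=
        congrArg Fin.val (congrFun hij k)
      have bounds : ∀ i, ((min ⌊m * (ω i k + 1 / 2)⌋₊ (m - 1) : ℕ) : ℝ) ≤ m * (ω i k + 1 / 2) ∧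
          m * (ω i k + 1 / 2) ≤ (min ⌊m * (ω i k + 1 / 2)⌋₊ (m - 1) : ℕ) + 1 := by
        intro i
        have h1 := abs_le.1 (hω i k)
        have h0 : 0 ≤ m * (ω i k + 1 / 2) := mul_nonneg hm'.le (by linarith)
        refine ⟨(Nat.cast_le.2 (min_le_left _ _)).trans (Nat.floor_le h0), ?_⟩
        rcases min_choice ⌊m * (ω i k + 1 / 2)⌋₊ (m - 1) with h | h <;> rw [h]
        · exact (Nat.lt_floor_add_one _).le
        · rw [Nat.cast_sub hm]
          push_cast
          nlinarith
      have hi := bounds i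
      have hj := bounds j
      rw [hk] at hi
      have e : (ω i - ω j) k = ω i k - ω j k := rfl
      rw [e, div_right_comm, div_self two_ne_zero, le_div_iff₀ hm', ← abs_of_pos hm', ← abs_mul,
        abs_le]
      constructor <;> nlinarith
    refine (norm_le_of_mem_cube this).trans (le_of_eq ?_)
    field_simp
  -- The points alone in their cell, on which c is injective.
  let S : Finset (Fin (2 * m ^ d)) := Finset.univ.filter fun i => ∀ j, c i = c j → i = j
  have hS : S.card ≤ m ^ d := by
    refine (Finset.card_le_card_of_injOn c (fun _ _ => Finset.mem_coe.2 (Finset.mem_univ _))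
      fun i hi j _ hij => ?_).trans (le_of_eq (b := m ^ d) (by simp))
    exact (Finset.mem_filter.1 (Finset.mem_coe.1 hi)).2 j hij
  have hSc : m ^ d ≤ Sᶜ.card := by
    rw [Finset.card_compl, Fintype.card_fin]
    omega
  calc (m : ℝ≥0∞) ^ d * ENNReal.ofReal (√d / m) ^ (-s)
      ≤ (Sᶜ.card : ℝ≥0∞) * ENNReal.ofReal (√d / m) ^ (-s) := by
        gcongr
        exact_mod_cast hSc
    _ = ∑ _i ∈ Sᶜ, ENNReal.ofReal (√d / m) ^ (-s) := by simp
    _ ≤ ∑ i ∈ Sᶜ, ∑ j, if i = j then 0 else riesz s (ω i) (ω j) := by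
        refine Finset.sum_le_sum fun i hi => ?_
        simp only [S, Finset.mem_compl, Finset.mem_filter, Finset.mem_univ, true_and,
          not_forall] at hi
        obtain ⟨j, hij, hne⟩ := hi
        refine le_trans ?_ (Finset.single_le_sum (fun _ _ => zero_le) (Finset.mem_univ j))
        rw [if_neg hne]
        exact le_riesz hs (hclose i j hij)
    _ ≤ _ := Finset.sum_le_sum_of_subset (Finset.subset_univ _)

theorem asymptoticMinEnergy_pos (hd : 0 < d) {s : ℝ} (hs : (d : ℝ) < s) :
    0 < asymptoticMinEnergy d s := by
  have hd' : (0 : ℝ) < d := by exact_mod_cast hd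
  have hs0 : 0 < s := hd'.trans hs
  have hp : 0 ≤ 1 + s / (d : ℝ) := by positivity
  have hsub : Tendsto (fun m : ℕ => 2 * m ^ d) atTop atTop :=
    (tendsto_pow_atTop hd.ne').const_mul_atTop' two_pos
  have hlim := (tendsto_scaledMinEnergy hd hs).comp hsub
  refine lt_of_lt_of_le ?_ (ge_of_tendsto (b := ENNReal.ofReal √d ^ (-s) /
    2 ^ (1 + s / (d : ℝ))) hlim ?_)
  · refine ENNReal.div_pos ?_ (by simp [ENNReal.rpow_eq_top_iff])
    simp [ENNReal.rpow_eq_zero_iff, hs0.le]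
  filter_upwards [eventually_gt_atTop 0] with m hm
  have hN : 0 < 2 * m ^ d := by positivity
  rw [Function.comp_apply, scaledMinEnergy, ENNReal.le_div_iff_mul_le
    (Or.inl (natCast_rpow_ne_zero hN _)) (Or.inl (natCast_rpow_ne_top hN _))]
  refine le_trans (le_of_eq ?_) (le_minEnergy_two_mul_pow hs0.le hm)
  have h1 := ofReal_div_natCast_rpow_neg (Real.sqrt_pos.2 hd') hm s
  have h2 := natCast_pow_mul_rpow hd hm s
  have h3 : ((2 * m ^ d : ℕ) : ℝ≥0∞) ^ (1 + s / (d : ℝ)) =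
      2 ^ (1 + s / (d : ℝ)) * ((m : ℝ≥0∞) ^ d * (m : ℝ≥0∞) ^ s) := by
    rw [h2]
    push_cast
    rw [ENNReal.mul_rpow_of_nonneg _ _ hp]
  rw [h1, h3, ← mul_assoc, ENNReal.div_mul_cancel (by simp [ENNReal.rpow_eq_zero_iff])
    (by simp [ENNReal.rpow_eq_top_iff])]
  ring

/-! ### Listing a configuration; lower bound for its energy -/

lemma tsum_comp_eq_tsum_mul {ι X : Type*} {x : ι → X} {m : X → ℕ}
    (hx : ∀ p, (x ⁻¹' {p}).encard = m p) (h : X → ℝ≥0∞) :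
    ∑' i, h (x i) = ∑' p, (m p : ℝ≥0∞) * h p := by
  rw [← ENNReal.tsum_fiberwise _ x]
  refine tsum_congr fun p => ?_
  calc ∑' i : x ⁻¹' {p}, h (x i) = ∑' _i : x ⁻¹' {p}, h p :=
        tsum_congr fun i => by rw [show x i = p from i.2]
    _ = _ := by
        rw [ENNReal.tsum_const, ← Set.encard, hx]
        simp

/-- The family `x` lists the points of the configuration `C`, with multiplicities. -/
def Config.IsListedBy {ι : Type*} (C : Config d) (x : ι → Space d) : Prop :=
  ∀ p, (x ⁻¹' {p}).encard = C p

lemma Config.IsListedBy.restrict {ι : Type*} {C : Config d} {x : ι → Space d}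
    (h : C.IsListedBy x) (A : Set (Space d)) (p : A) :
    ((fun i : {i // x i ∈ A} => (⟨x i, i.2⟩ : A)) ⁻¹' {p}).encard = C p := by
  rw [← h p, ← (Subtype.val_injective (p := fun i => x i ∈ A)).encard_image]
  congr 1
  ext i
  simp only [Set.mem_image, Set.mem_preimage, Set.mem_singleton_iff, Subtype.exists,
    exists_and_right, exists_eq_right, ← Subtype.coe_inj]
  exact ⟨fun ⟨_, h⟩ => h, fun h => ⟨h ▸ p.2, h⟩⟩

lemma Config.IsListedBy.count_eq {ι : Type*} {C : Config d} {x : ι → Space d}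
    (h : C.IsListedBy x) (A : Set (Space d)) :
    C.count A = ∑' _i : {i // x i ∈ A}, 1 := by
  have := tsum_comp_eq_tsum_mul (h.restrict A) fun _ => 1
  simpa [Config.count] using this.symm

/-- For a particle i at p, the other particles number C p - 1 at p and C q at each q ≠ p; this is
the count encoded in `Config.pairs`. -/
lemma Config.IsListedBy.interaction_eq {ι : Type*} {C : Config d} {x : ι → Space d}
    (h : C.IsListedBy x) (s : ℝ) (A : Set (Space d)) :
    C.interaction s A A = familyEnergy s fun i : {i // x i ∈ A} => x i := by
  classical
  set y : {i // x i ∈ A} → A := fun i => ⟨x i, i.2⟩ with hy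
  have hy' : ∀ p : A, (y ⁻¹' {p}).encard = C p := h.restrict A
  have inner : ∀ i : {i // x i ∈ A}, (∑' j : {i // x i ∈ A}, if i = j then 0 else riesz s (x i) (x j)) =
      ∑' q : A, ((if y i = q then C q - 1 else C q : ℕ) : ℝ≥0∞) * riesz s (y i : Space d) (q : Space d) := by
    intro i
    have hsub : ∀ q : A, ((fun j : {j // j ≠ i} => y j) ⁻¹' {q}).encard =
        (if y i = q then C q - 1 else C q : ℕ) := by
      intro q
      rw [← (Subtype.val_injective (p := fun j => j ≠ i)).encard_image]
      have himg : (Subtype.val '' ((fun j : {j // j ≠ i} => y j) ⁻¹' {q})) =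
          (y ⁻¹' {q}) \ {i} := by
        ext j
        simp [and_comm]
      rw [himg]
      split_ifs with hq
      · rw [Set.encard_sdiff_singleton_of_mem (show i ∈ y ⁻¹' {q} from hq), hy' q]
        norm_cast
      · rw [Set.sdiff_singleton_eq_self (by simpa using hq), hy' q]
    rw [← tsum_comp_eq_tsum_mul hsub fun q : A => riesz s (y i : Space d) (q : Space d)]
    have := tsum_subtype {j | j ≠ i} fun j => riesz s (x i) (x j)
    refine Eq.trans ?_ this.symm
    refine tsum_congr fun j => ?_
    by_cases hij : i = j <;> simp [Set.indicator, hij, eq_comm]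
  rw [familyEnergy_eq_tsum]
  simp_rw [inner]
  rw [tsum_comp_eq_tsum_mul hy' fun p : A => ∑' q : A,
    ((if p = q then C q - 1 else C q : ℕ) : ℝ≥0∞) * riesz s (p : Space d) (q : Space d)]
  refine tsum_congr fun p => ?_
  rw [← ENNReal.tsum_mul_left]
  refine tsum_congr fun q => ?_
  rw [← mul_assoc]
  congr 1
  rw [Config.pairs]
  by_cases hpq : p = q
  · subst hpq; simp
  · have : (p : Space d) ≠ q := fun h => hpq (Subtype.ext h)
    simp [hpq, this]

lemma Config.isListedBy_sigma (C : Config d) :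
    C.IsListedBy (Sigma.fst : (Σ p, Fin (C p)) → Space d) := by
  intro p
  rw [← Set.range_sigmaMk, ← Set.image_univ, sigma_mk_injective.encard_image]
  simp

lemma Config.finite_inter_support (C : Config d) {A : Set (Space d)}
    (hA : Bornology.IsBounded A) : (A ∩ {p | C p ≠ 0}).Finite := by
  refine (LocallyFiniteSupport.finite_inter_support_of_isCompact
    (Function.locallyFinsupp.locallyFiniteSupport C) hA.isCompact_closure).subset ?_
  exact Set.inter_subset_inter_left _ subset_closure

lemma Config.exists_minEnergy_le_interaction (C : Config d) (s : ℝ) {R : ℝ} (hR : 0 < R) :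
    ∃ n : ℕ, C.count (cube d R) = n ∧ ENNReal.ofReal R ^ (-s) * minEnergy s (cube d 1) n ≤
      C.interaction s (cube d R) (cube d R) := by
  have hC := C.isListedBy_sigma
  have hfin : Finite {σ : Σ p, Fin (C p) // σ.1 ∈ cube d R} := by
    refine ((C.finite_inter_support (isBounded_cube R)).preimage' (f := Sigma.fst) (fun p _ =>
      Set.finite_of_encard_eq_coe (hC p))).subset fun σ hσ => ⟨hσ, ?_⟩
    intro h0
    exact (Fin.cast h0 σ.2).elim0
  have : Fintype {σ : Σ p, Fin (C p) // σ.1 ∈ cube d R} := Fintype.ofFinite _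
  refine ⟨Fintype.card {σ : Σ p, Fin (C p) // σ.1 ∈ cube d R}, ?_, ?_⟩
  · rw [hC.count_eq]
    simp
  · rw [hC.interaction_eq, ← familyEnergy_comp_equiv s _ (Fintype.equivFin _).symm]
    exact minEnergy_cube_one_le hR fun i => ((Fintype.equivFin _).symm i).2

/-- For b < 1 and large R the cube K_R holds n ≥ bR^d points. For a below the constant their energy
is at least R^{-s} a n^{1+s/d} ≥ a b^{1+s/d} R^d. Then b → 1, and a is arbitrary. -/
theorem asymptoticMinEnergy_le_energy (hd : 0 < d) {s : ℝ} (hs : (d : ℝ) < s) {C : Config d}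
    (hC : C ∈ configOfDensity d 1) : asymptoticMinEnergy d s ≤ C.energy s := by
  have hd' : (0 : ℝ) < d := by exact_mod_cast hd
  have hs0 : 0 < s := hd'.trans hs
  have hp : 0 ≤ 1 + s / (d : ℝ) := by positivity
  refine le_of_forall_lt_imp_le_of_dense fun a ha => ?_
  have key : ∀ b : ℝ≥0∞, 0 < b → b < 1 → a * b ^ (1 + s / (d : ℝ)) ≤ C.energy s := by
    intro b hb0 hb
    have hdens : ∀ᶠ R : ℝ in atTop, b < C.count (cube d R) / ENNReal.ofReal R ^ d :=
      eventually_lt_of_lt_liminf (by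
        rw [show liminf _ _ = (1 : ℝ≥0∞) from hC]; exact hb)
    obtain ⟨N₀, hN₀⟩ := eventually_atTop.1
      ((tendsto_scaledMinEnergy hd hs).eventually (lt_mem_nhds ha))
    have hlarge : ∀ᶠ R : ℝ in atTop, ((N₀ + 1 : ℕ) : ℝ≥0∞) < b * ENNReal.ofReal R ^ d := by
      have h1 : Tendsto (fun R : ℝ => b * ENNReal.ofReal R ^ d) atTop (𝓝 ⊤) := by
        have h2 : Tendsto (fun R : ℝ => ENNReal.ofReal (R ^ d)) atTop (𝓝 ⊤) :=
          ENNReal.tendsto_ofReal_atTop.comp (tendsto_pow_atTop hd.ne')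
        have h3 := ENNReal.Tendsto.const_mul (a := b) h2 (Or.inl (by simp))
        rw [ENNReal.mul_top hb0.ne'] at h3
        refine h3.congr' ?_
        filter_upwards [eventually_ge_atTop 0] with R hR
        rw [ENNReal.ofReal_pow hR]
      exact h1.eventually (lt_mem_nhds (ENNReal.natCast_lt_top _))
    refine le_liminf_of_le (by isBoundedDefault) ?_
    filter_upwards [hdens, hlarge, eventually_gt_atTop 0] with R h1 h2 hR
    obtain ⟨n, hn, hE⟩ := C.exists_minEnergy_le_interaction s hR
    have hr0 : ENNReal.ofReal R ≠ 0 := by simpa using hR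
    have hrt : ENNReal.ofReal R ≠ ⊤ := ENNReal.ofReal_ne_top
    rw [hn] at h1
    have h3 : b * ENNReal.ofReal R ^ d ≤ n :=
      (ENNReal.le_div_iff_mul_le (Or.inl (pow_ne_zero _ hr0)) (Or.inl (by finiteness))).1 h1.le
    have hnN : N₀ + 1 < n := by exact_mod_cast h2.trans_le h3
    have hn0 : 0 < n := by omega
    have ha' := (hN₀ n (by omega)).le
    rw [ENNReal.le_div_iff_mul_le (Or.inl (pow_ne_zero _ hr0)) (Or.inl (by finiteness))]
    refine le_trans ?_ hE
    rw [minEnergy_eq_mul hn0]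
    have h4 : ENNReal.ofReal R ^ d = ENNReal.ofReal R ^ (-s) *
        (ENNReal.ofReal R ^ d) ^ (1 + s / (d : ℝ)) := by
      rw [← ENNReal.rpow_natCast, ← ENNReal.rpow_mul, ← ENNReal.rpow_add _ _ hr0 hrt]
      congr 1
      field_simp
      ring
    calc a * b ^ (1 + s / (d : ℝ)) * ENNReal.ofReal R ^ d
        = ENNReal.ofReal R ^ (-s) * (a * (b * ENNReal.ofReal R ^ d) ^ (1 + s / (d : ℝ))) := by
          rw [ENNReal.mul_rpow_of_nonneg _ _ hp]
          conv_lhs => rw [h4]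
          ring
      _ ≤ _ := by gcongr
  have hlim : Tendsto (fun b : ℝ≥0∞ => a * b ^ (1 + s / (d : ℝ))) (𝓝[<] 1) (𝓝 a) := by
    have h1 := ((ENNReal.continuous_rpow_const (y := 1 + s / (d : ℝ))).tendsto 1)
    have h2 := ENNReal.Tendsto.const_mul (a := a) h1 (Or.inl (by simp))
    simp only [ENNReal.one_rpow, mul_one] at h2
    exact h2.mono_left nhdsWithin_le_nhds
  have : (𝓝[<] (1 : ℝ≥0∞)).NeBot := nhdsLT_neBot_of_exists_lt ⟨0, one_pos⟩
  refine le_of_tendsto hlim ?_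
  filter_upwards [Ioo_mem_nhdsLT (zero_lt_one (α := ℝ≥0∞))] with b hb
  exact key b hb.1 hb.2

/-! ### Periodic configurations: density and energy -/

/-- The configuration listed by a locally finite family of points. -/
def Config.ofFamily {ι : Type*} (x : ι → Space d)
    (hx : ∀ B : Set (Space d), Bornology.IsBounded B → (x ⁻¹' B).Finite) : Config d where
  toFun p := (x ⁻¹' {p}).ncard
  supportWithinDomain' := Set.subset_univ _
  supportLocallyFiniteWithinDomain' z _ := by
    refine ⟨Metric.ball z 1, Metric.ball_mem_nhds z one_pos,
      ((hx (Metric.ball z 1) Metric.isBounded_ball).image x).subset ?_⟩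
    rintro p ⟨hp, hp'⟩
    obtain ⟨i, hi⟩ := Set.nonempty_of_ncard_ne_zero hp'
    have hi' : x i = p := hi
    exact ⟨i, by simpa [hi'] using hp, hi'⟩

lemma Config.ofFamily_apply {ι : Type*} (x : ι → Space d)
    (hx : ∀ B : Set (Space d), Bornology.IsBounded B → (x ⁻¹' B).Finite) (p : Space d) :
    Config.ofFamily x hx p = (x ⁻¹' {p}).ncard := rfl

lemma Config.isListedBy_ofFamily {ι : Type*} (x : ι → Space d)
    (hx : ∀ B : Set (Space d), Bornology.IsBounded B → (x ⁻¹' B).Finite) :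
    (Config.ofFamily x hx).IsListedBy x := fun p => by
  rw [Config.ofFamily_apply, (hx _ Bornology.isBounded_singleton).cast_ncard_eq]

open MeasureTheory in
lemma volume_cube (R : ℝ) : volume (cube d R) = ENNReal.ofReal R ^ d := by
  have h : cube d R = WithLp.ofLp ⁻¹'
      (Set.Icc (fun _ => -(R / 2)) (fun _ => R / 2)) := by
    ext x
    simp only [mem_cube, abs_le, Set.mem_preimage, Set.mem_Icc, Pi.le_def, ← forall_and]
  rw [h, (PiLp.volume_preserving_ofLp (Fin d)).measure_preimage
    measurableSet_Icc.nullMeasurableSet, Real.volume_Icc_pi]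
  simp

section Lattice

variable (Λ : Submodule ℤ (Space d)) [DiscreteTopology Λ]

lemma finite_lattice_preimage (c : Space d) {t : ℝ} (ht : 0 < t) {B : Set (Space d)}
    (hB : Bornology.IsBounded B) : {v : Λ | t • (c + (v : Space d)) ∈ B}.Finite := by
  have H : IsClosed (X := Space d) Λ := @AddSubgroup.isClosed_of_discrete _ _ _ _ _
    Λ.toAddSubgroup (inferInstanceAs (DiscreteTopology Λ))
  obtain ⟨r, hr⟩ := isBounded_iff_forall_norm_le.1 hB
  refine ((Metric.finite_isBounded_inter_isClosed DiscreteTopology.isDiscrete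
    (Metric.isBounded_closedBall (x := (0 : Space d)) (r := r / t + ‖c‖)) H).preimage_embedding
    (.subtype _)).subset ?_
  intro v hv
  have h1 := hr _ hv
  rw [norm_smul, Real.norm_of_nonneg ht.le, mul_comm, ← le_div_iff₀ ht] at h1
  have h2 : ‖(v : Space d)‖ ≤ ‖c + (v : Space d)‖ + ‖c‖ := by
    calc ‖(v : Space d)‖ = ‖(c + (v : Space d)) - c‖ := by simp
      _ ≤ _ := norm_sub_le _ _
  simpa using h2.trans (by linarith)

/-- The points of the `tΛ`-periodic family generated by the points `t • x i`. -/
def periodicFamily {ι : Type*} (t : ℝ) (x : ι → Space d) (q : ι × Λ) : Space d :=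
  t • (x q.1 + (q.2 : Space d))

lemma periodicFamily_finite {ι : Type*} [Finite ι] {t : ℝ} (ht : 0 < t) (x : ι → Space d)
    (B : Set (Space d)) (hB : Bornology.IsBounded B) :
    (periodicFamily Λ t x ⁻¹' B).Finite := by
  refine (Set.finite_iUnion fun i =>
    (finite_lattice_preimage Λ (x i) ht hB).image (Prod.mk i)).subset ?_
  rintro ⟨i, v⟩ h
  exact Set.mem_iUnion.2 ⟨i, v, h, rfl⟩

/-- The `tΛ`-periodic configuration generated by the points `t • x i`. -/
def periodicConfig {ι : Type*} [Finite ι] {t : ℝ} (ht : 0 < t) (x : ι → Space d) : Config d :=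
  Config.ofFamily (periodicFamily Λ t x) (periodicFamily_finite Λ ht x)

lemma isListedBy_periodicConfig {ι : Type*} [Finite ι] {t : ℝ} (ht : 0 < t) (x : ι → Space d) :
    (periodicConfig Λ ht x).IsListedBy (periodicFamily Λ t x) :=
  Config.isListedBy_ofFamily _ _

lemma periodicConfig_isPeriodic {ι : Type*} [Finite ι] {t : ℝ} (ht : 0 < t) (x : ι → Space d) :
    (periodicConfig Λ ht x).IsPeriodic t Λ := by
  intro v hv p
  rw [periodicConfig, Config.ofFamily_apply, Config.ofFamily_apply]
  -- Translation by t • v permutes the indices of the family, carrying the particles at p to those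
  -- at p + t • v.
  let e : ι × Λ ≃ ι × Λ := (Equiv.refl ι).prodCongr (Equiv.addRight (⟨v, hv⟩ : Λ))
  have h : e '' (periodicFamily Λ t x ⁻¹' {p}) = periodicFamily Λ t x ⁻¹' {p + t • v} := by
    rw [e.image_eq_preimage_symm]
    ext ⟨i, w⟩
    have : t • (x i + ((w : Space d) - v)) = p ↔ t • (x i + (w : Space d)) = p + t • v := by
      rw [← sub_eq_iff_eq_add, ← smul_sub, add_sub_assoc]
    simpa [e, periodicFamily, sub_eq_add_neg] using this
  rw [← h, Set.ncard_image_of_injective _ e.injective]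

variable [IsZLattice ℝ Λ]

-- The volume of a cube unfolds into integrals over the translates of a fundamental domain F of
-- volume 1. Replacing y ∈ F by x moves points by a bounded amount, so counting and volume agree up
-- to a bounded change of R.
open MeasureTheory in
open scoped Classical in
lemma exists_count_lattice_bounds (hΛ : ZLattice.covolume Λ = 1) (x : Space d) :
    ∃ c : ℝ, ∀ R : ℝ, ENNReal.ofReal (R - c) ^ d ≤
        ∑' v : Λ, (if x + (v : Space d) ∈ cube d R then 1 else 0) ∧
      ∑' v : Λ, (if x + (v : Space d) ∈ cube d R then 1 else 0) ≤ ENNReal.ofReal (R + c) ^ d := by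
  let b := Module.Free.chooseBasis ℤ Λ
  let F := ZSpan.fundamentalDomain (b.ofZLatticeBasis ℝ)
  have hF : IsAddFundamentalDomain Λ F volume := ZLattice.isAddFundamentalDomain b volume
  have hFv : volume F = 1 := by
    have h := ZLattice.covolume_eq_measure_fundamentalDomain Λ volume hF
    rw [hΛ, Measure.real, eq_comm, ENNReal.toReal_eq_one_iff] at h
    exact h
  have hFm : MeasurableSet F := ZSpan.fundamentalDomain_measurableSet _
  obtain ⟨ρ, hρ⟩ := isBounded_iff_forall_norm_le.1
    (ZSpan.fundamentalDomain_isBounded (b.ofZLatticeBasis ℝ))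
  have : MeasurableVAdd Λ (Space d) := (inferInstance : MeasurableVAdd Λ.toAddSubgroup (Space d))
  have : VAddInvariantMeasure Λ (Space d) volume :=
    (inferInstance : VAddInvariantMeasure Λ.toAddSubgroup (Space d) volume)
  have hvol : ∀ R, ENNReal.ofReal R ^ d =
      ∑' v : Λ, ∫⁻ y in F, (cube d R).indicator 1 ((v : Space d) + y) := by
    intro R
    rw [← volume_cube, ← lintegral_indicator_one (isClosed_cube R).measurableSet,
      hF.lintegral_eq_tsum'']
    rfl
  have hconst : ∀ R, ∑' v : Λ, (if x + (v : Space d) ∈ cube d R then (1 : ℝ≥0∞) else 0) =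
      ∑' v : Λ, ∫⁻ _y in F, (if x + (v : Space d) ∈ cube d R then (1 : ℝ≥0∞) else 0) := by
    intro R
    simp [hFv]
  have hdist : ∀ y ∈ F, ‖y - x‖ ≤ ρ + ‖x‖ := fun y hy =>
    (norm_sub_le _ _).trans (by linarith [hρ y hy])
  refine ⟨2 * (ρ + ‖x‖), fun R => ?_⟩
  rw [hvol, hvol, hconst]
  constructor
  · refine ENNReal.tsum_le_tsum fun v => setLIntegral_mono' hFm fun y hy => ?_
    by_cases h : (v : Space d) + y ∈ cube d (R - 2 * (ρ + ‖x‖))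
    · have h1 : x + (v : Space d) ∈ cube d R := by
        have := add_mem_cube h (y := x - y) (r := ρ + ‖x‖)
          (by rw [norm_sub_rev]; exact hdist y hy)
        rw [sub_add_cancel] at this
        convert this using 1
        abel
      rw [if_pos h1]
      exact Set.indicator_le_self _ _ _
    · simp [h]
  · refine ENNReal.tsum_le_tsum fun v => setLIntegral_mono' hFm fun y hy => ?_
    split_ifs with h
    · have h1 : (v : Space d) + y ∈ cube d (R + 2 * (ρ + ‖x‖)) := by
        have := add_mem_cube h (hdist y hy)
        convert this using 1
        abel
      simp [h1]
    · exact zero_le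

open scoped Classical in
lemma tendsto_count_lattice (hΛ : ZLattice.covolume Λ = 1) (x : Space d) {t : ℝ}
    (ht : 0 < t) :
    Tendsto (fun R : ℝ => (∑' v : Λ, if x + (v : Space d) ∈ cube d (R / t) then (1 : ℝ≥0∞) else 0) /
      ENNReal.ofReal R ^ d) atTop (𝓝 ((ENNReal.ofReal t ^ d)⁻¹)) := by
  obtain ⟨c, hc⟩ := exists_count_lattice_bounds Λ hΛ x
  have key : ∀ c : ℝ, Tendsto (fun R : ℝ => ENNReal.ofReal (R / t + c) ^ d / ENNReal.ofReal R ^ d)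
      atTop (𝓝 ((ENNReal.ofReal t ^ d)⁻¹)) := by
    intro c
    have h1 : Tendsto (fun R : ℝ => t⁻¹ + c * R⁻¹) atTop (𝓝 (t⁻¹)) := by
      simpa using (tendsto_inv_atTop_zero.const_mul c).const_add t⁻¹
    have h2 := (ENNReal.continuous_pow d).tendsto _ |>.comp (ENNReal.tendsto_ofReal h1)
    rw [ENNReal.ofReal_inv_of_pos ht, ← ENNReal.inv_pow] at h2
    refine h2.congr' ?_
    filter_upwards [eventually_gt_atTop 0] with R hR
    have e : t⁻¹ + c * R⁻¹ = (R / t + c) / R := by field_simp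
    rw [Function.comp_apply, e, ENNReal.ofReal_div_of_pos hR]
    simp only [div_eq_mul_inv, mul_pow, ENNReal.inv_pow]
  refine tendsto_of_tendsto_of_tendsto_of_le_of_le (key (-c)) (key c) (fun R => ?_) fun R => ?_
  · exact ENNReal.div_le_div_right (hc (R / t)).1 _
  · exact ENNReal.div_le_div_right (hc (R / t)).2 _

/-- A configuration has asymptotic density `1` if `|C ∩ K_R| / R^d` tends to `1`. -/
def Config.HasUnitDensity (C : Config d) : Prop :=
  Tendsto (fun R : ℝ => C.count (cube d R) / ENNReal.ofReal R ^ d) atTop (𝓝 1)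

lemma Config.HasUnitDensity.mem {C : Config d} (h : C.HasUnitDensity) :
    C ∈ configOfDensity d 1 := h.liminf_eq

open scoped Classical in
/-- The Riesz energy per period of the `Λ`-periodic family generated by the points `x i`. -/
def periodicEnergy {ι : Type*} (s : ℝ) (x : ι → Space d) : ℝ≥0∞ :=
  ∑' i, ∑' q : ι × Λ, if q = (i, 0) then 0 else riesz s (x i) (x q.1 + (q.2 : Space d))

lemma tendsto_count_periodicConfig (hΛ : ZLattice.covolume Λ = 1) {ι : Type*}
    [Fintype ι] {t : ℝ} (ht : 0 < t) (x : ι → Space d) :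
    Tendsto (fun R : ℝ => (periodicConfig Λ ht x).count (cube d R) / ENNReal.ofReal R ^ d) atTop
      (𝓝 (Fintype.card ι * (ENNReal.ofReal t ^ d)⁻¹)) := by
  classical
  have h := tendsto_finsetSum Finset.univ fun i (_ : i ∈ Finset.univ) =>
    tendsto_count_lattice Λ hΛ (x i) ht
  simp only [Finset.sum_const, Finset.card_univ, nsmul_eq_mul] at h
  refine h.congr fun R => ?_
  rw [(isListedBy_periodicConfig Λ ht x).count_eq]
  have e := tsum_subtype {q | periodicFamily Λ t x q ∈ cube d R} fun _ => (1 : ℝ≥0∞)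
  refine Eq.trans ?_ (congrArg (· / ENNReal.ofReal R ^ d) e.symm)
  rw [ENNReal.tsum_prod', tsum_fintype]
  simp only [div_eq_mul_inv, Finset.sum_mul]
  refine Finset.sum_congr rfl fun i _ => ?_
  congr 1
  refine tsum_congr fun v => ?_
  simp only [Set.indicator, Set.mem_ofPred_eq, periodicFamily, smul_mem_cube ht, div_eq_mul_inv]

/-- A particle's interaction within K_R is at most its interaction with the whole configuration. By
periodicity the latter depends only on its class i, and each class has asymptotically R^d / t^d
particles in K_R. -/
lemma limsup_interaction_periodicConfig_le (hΛ : ZLattice.covolume Λ = 1)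
    {ι : Type*} [Fintype ι] (s : ℝ) {t : ℝ} (ht : 0 < t) (x : ι → Space d) :
    limsup (fun R : ℝ => (periodicConfig Λ ht x).interaction s (cube d R) (cube d R) /
      ENNReal.ofReal R ^ d) atTop ≤
      ENNReal.ofReal t ^ (-s) * (ENNReal.ofReal t ^ d)⁻¹ * periodicEnergy Λ s x := by
  classical
  set e : ι → ℝ≥0∞ := fun i => ∑' q : ι × Λ,
    if q = (i, 0) then 0 else riesz s (x i) (x q.1 + (q.2 : Space d)) with he
  have hrow : ∀ i (v : Λ), (∑' q, if (i, v) = q then 0 else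
      riesz s (periodicFamily Λ t x (i, v)) (periodicFamily Λ t x q)) =
      ENNReal.ofReal t ^ (-s) * e i := by
    intro i v
    rw [he, ← ENNReal.tsum_mul_left, ← ((Equiv.refl ι).prodCongr (Equiv.addRight v)).tsum_eq]
    refine tsum_congr fun ⟨j, w⟩ => ?_
    simp only [Equiv.prodCongr_apply, Equiv.coe_refl, Prod.map_apply, id_eq, Equiv.coe_addRight,
      Prod.mk.injEq, right_eq_add, mul_ite, mul_zero]
    have h1 : riesz s (periodicFamily Λ t x (i, v)) (periodicFamily Λ t x (j, w + v)) =
        ENNReal.ofReal t ^ (-s) * riesz s (x i) (x j + (w : Space d)) := by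
      rw [periodicFamily, periodicFamily, riesz_smul s ht]
      simp only [Submodule.coe_add]
      rw [← add_assoc, riesz_add_right]
    rw [h1]
    simp only [eq_comm]
  have hle : ∀ R : ℝ, (periodicConfig Λ ht x).interaction s (cube d R) (cube d R) /
      ENNReal.ofReal R ^ d ≤ ∑ i, ENNReal.ofReal t ^ (-s) * e i *
        ((∑' v : Λ, if x i + (v : Space d) ∈ cube d (R / t) then (1 : ℝ≥0∞) else 0) /
          ENNReal.ofReal R ^ d) := by
    intro R
    rw [(isListedBy_periodicConfig Λ ht x).interaction_eq,
      familyEnergy_eq_tsum]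
    simp only [div_eq_mul_inv, ← mul_assoc]
    rw [← Finset.sum_mul]
    gcongr
    calc _ ≤ ∑' p : {p // periodicFamily Λ t x p ∈ cube d R}, ∑' q, (if (p : ι × Λ) = q then 0
            else riesz s (periodicFamily Λ t x p) (periodicFamily Λ t x q)) := by
          refine ENNReal.tsum_le_tsum fun p => ?_
          refine le_trans (le_of_eq ?_) (ENNReal.tsum_comp_le_tsum_of_injective
            (f := ((↑) : {p // periodicFamily Λ t x p ∈ cube d R} → ι × Λ))
            Subtype.val_injective _)
          refine tsum_congr fun q => ?_
          simp only [Subtype.ext_iff]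
      _ = ∑' p : ι × Λ, Set.indicator {p | periodicFamily Λ t x p ∈ cube d R} (fun p => ∑' q,
            (if p = q then 0
            else riesz s (periodicFamily Λ t x p) (periodicFamily Λ t x q))) p :=
          tsum_subtype {p | periodicFamily Λ t x p ∈ cube d R} fun p => ∑' q, if p = q then 0
            else riesz s (periodicFamily Λ t x p) (periodicFamily Λ t x q)
      _ = _ := by
          rw [ENNReal.tsum_prod', tsum_fintype]
          refine Finset.sum_congr rfl fun i _ => ?_
          rw [← ENNReal.tsum_mul_left]
          refine tsum_congr fun v => ?_
          simp only [Set.indicator, Set.mem_ofPred_eq, hrow]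
          simp only [periodicFamily, smul_mem_cube ht, mul_ite, mul_one, mul_zero,
            div_eq_mul_inv]
  have hlim : Tendsto (fun R : ℝ => ∑ i, ENNReal.ofReal t ^ (-s) * e i *
        ((∑' v : Λ, if x i + (v : Space d) ∈ cube d (R / t) then (1 : ℝ≥0∞) else 0) /
          ENNReal.ofReal R ^ d)) atTop
      (𝓝 (∑ i, ENNReal.ofReal t ^ (-s) * e i * (ENNReal.ofReal t ^ d)⁻¹)) := by
    refine tendsto_finsetSum _ fun i _ => ENNReal.Tendsto.const_mul
      (tendsto_count_lattice Λ hΛ (x i) ht) (Or.inl ?_)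
    simp
  refine (limsup_le_limsup (Eventually.of_forall hle)).trans (le_of_eq ?_)
  rw [hlim.limsup_eq, periodicEnergy, tsum_fintype, Finset.mul_sum]
  refine Finset.sum_congr rfl fun i _ => ?_
  ring

end Lattice

/-! ### Filling an open set with cells; energy per period -/

-- By inner regularity a compact K ⊆ U already has volume above a. Grid cells that meet K cover it,
-- and they stay in U once their diameter is less than the room between K and the complement of U.
open MeasureTheory in
lemma exists_cells_in_open {U : Set (Space d)} (hU : IsOpen U) {a : ℝ≥0∞} (ha : a < volume U) :
    ∃ (h : ℝ) (κ : Finset (Fin d → ℤ)), 0 < h ∧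
      (∀ k ∈ κ, ∀ y ∈ cube d h, h • intPoint k + y ∈ U) ∧
      a ≤ κ.card * ENNReal.ofReal h ^ d := by
  classical
  obtain ⟨K, hKU, hK, haK⟩ := hU.exists_lt_isCompact ha
  obtain ⟨ρ, hρ, hρU⟩ := hK.exists_thickening_subset_open hU hKU
  -- Chosen so that the cell diameter √d · h is less than ρ.
  set h : ℝ := ρ / (√d + 1) with hh
  have hh0 : 0 < h := by positivity
  have hhρ : √d * h < ρ := by
    rw [hh, mul_div_assoc', div_lt_iff₀ (by positivity)]
    nlinarith [Real.sqrt_nonneg d]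
  let r : Space d → Fin d → ℤ := fun y i => round (y i / h)
  have hr : ∀ y, y - h • intPoint (r y) ∈ cube d h := by
    intro y i
    have h1 := abs_sub_round (y i / h)
    have h2 : (y - h • intPoint (r y)) i = h * (y i / h - round (y i / h)) := by
      simp [r]; field_simp
    rw [h2, abs_mul, abs_of_pos hh0]
    nlinarith
  have hfin : (r '' K).Finite := by
    obtain ⟨B, hB⟩ := isBounded_iff_forall_norm_le.1 hK.isBounded
    refine (Set.finite_Icc (fun _ : Fin d => -⌈B / h + 1⌉) fun _ => ⌈B / h + 1⌉).subset ?_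
    rintro _ ⟨y, hy, rfl⟩
    have key : ∀ i, |(r y i : ℝ)| ≤ ⌈B / h + 1⌉ := fun i => by
      have h1 := abs_sub_round (y i / h)
      have h2 : |y i / h| ≤ B / h := by
        rw [abs_div, abs_of_pos hh0]
        gcongr
        exact (PiLp.norm_apply_le y i).trans (hB y hy)
      have h3 : |(r y i : ℝ)| ≤ |y i / h| + |y i / h - round (y i / h)| := by
        have := abs_sub (y i / h) (y i / h - round (y i / h))
        rwa [sub_sub_cancel] at this
      have h4 := Int.le_ceil (B / h + 1)
      linarith
    refine ⟨fun i => ?_, fun i => ?_⟩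
    · have := (abs_le.1 (key i)).1
      exact_mod_cast this
    · have := (abs_le.1 (key i)).2
      exact_mod_cast this
  refine ⟨h, hfin.toFinset, hh0, ?_, ?_⟩
  · intro k hk y hy
    obtain ⟨z, hz, rfl⟩ := hfin.mem_toFinset.1 hk
    refine hρU (Metric.mem_thickening_iff.2 ⟨z, hz, ?_⟩)
    have h1 : y - (z - h • intPoint (r z)) ∈ cube d (2 * h) := fun i => by
      have e1 := hy i
      have e2 := hr z i
      have e3 := abs_sub (y i) ((z - h • intPoint (r z)) i)
      calc |(y - (z - h • intPoint (r z))) i| = |y i - (z - h • intPoint (r z)) i| := rfl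
        _ ≤ _ := by linarith
    have h2 := norm_le_of_mem_cube h1
    rw [dist_eq_norm]
    calc ‖h • intPoint (r z) + y - z‖ = ‖y - (z - h • intPoint (r z))‖ := by congr 1; abel
      _ ≤ √d * (2 * h / 2) := h2
      _ < ρ := by rwa [mul_div_cancel_left₀ h two_ne_zero]
  · calc a ≤ volume K := haK.le
      _ ≤ volume (⋃ k ∈ hfin.toFinset, (fun y => -(h • intPoint k) + y) ⁻¹' cube d h) := by
          refine measure_mono fun y hy => ?_
          simp only [Set.mem_iUnion]
          refine ⟨r y, hfin.mem_toFinset.2 ⟨y, hy, rfl⟩, ?_⟩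
          have := hr y
          rwa [sub_eq_neg_add] at this
      _ ≤ ∑ k ∈ hfin.toFinset, volume ((fun y => -(h • intPoint k) + y) ⁻¹' cube d h) :=
          measure_biUnion_finset_le _ _
      _ = _ := by
          simp only [measure_preimage_add, volume_cube, Finset.sum_const, nsmul_eq_mul]

section Lattice

variable (Λ : Submodule ℤ (Space d))

lemma periodicEnergy_comp_le {ι κ : Type*} (s : ℝ) (x : ι → Space d) {f : κ → ι}
    (hf : Function.Injective f) : periodicEnergy Λ s (x ∘ f) ≤ periodicEnergy Λ s x := by
  classical
  unfold periodicEnergy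
  refine le_trans ?_ (ENNReal.tsum_comp_le_tsum_of_injective hf _)
  refine ENNReal.tsum_le_tsum fun i => ?_
  refine le_trans ?_ (ENNReal.tsum_comp_le_tsum_of_injective
    (f := Prod.map f (id : Λ → Λ)) (hf.prodMap Function.injective_id) _)
  refine ENNReal.tsum_le_tsum fun q => ?_
  simp only [Prod.ext_iff, Function.comp_apply, Prod.map_fst, Prod.map_snd, id_eq, hf.eq_iff,
    le_refl]

/-- Interactions are of three kinds: inside a cell (e), between distinct cells of one period (w 0),
and with the translate by v ≠ 0 (w v). -/
lemma periodicEnergy_cells_le {κ : Type*} [Fintype κ] {n : ℕ} {s : ℝ} (x : κ × Fin n → Space d)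
    {e : ℝ≥0∞} {w : Λ → ℝ≥0∞} (he : ∀ k, familyEnergy s (fun a => x (k, a)) ≤ e)
    (hw0 : ∀ k k' a b, k ≠ k' → riesz s (x (k, a)) (x (k', b)) ≤ w 0)
    (hw : ∀ i j, ∀ v : Λ, v ≠ 0 → riesz s (x i) (x j + (v : Space d)) ≤ w v) :
    periodicEnergy Λ s x ≤ Fintype.card κ * e +
      (Fintype.card κ * n) * ((Fintype.card κ * n) * ∑' v, w v) := by
  classical
  have hcell : ∀ k (a : Fin n), ∀ q : (κ × Fin n) × Λ, (if q = ((k, a), 0) then 0 else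
      riesz s (x (k, a)) (x q.1 + (q.2 : Space d))) ≤ (if q.2 = 0 then (if k = q.1.1 then
        (if a = q.1.2 then 0 else riesz s (x (k, a)) (x (k, q.1.2))) else 0) else 0) + w q.2 := by
    rintro k a ⟨⟨k', b⟩, v⟩
    by_cases hv : v = 0
    · subst hv
      by_cases hk : k = k'
      · subst hk
        by_cases hab : a = b
        · simp [hab]
        · simp [hab, Ne.symm hab]
      · simpa [hk, Ne.symm hk] using hw0 k k' a b hk
    · simpa [hv] using hw (k, a) (k', b) v hv
  calc periodicEnergy Λ s x
      ≤ ∑' i : κ × Fin n, ∑' q : (κ × Fin n) × Λ, ((if q.2 = 0 then (if i.1 = q.1.1 then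
        (if i.2 = q.1.2 then 0 else riesz s (x i) (x (i.1, q.1.2))) else 0) else 0) + w q.2) := by
        refine ENNReal.tsum_le_tsum fun i => ENNReal.tsum_le_tsum fun q => ?_
        convert hcell i.1 i.2 q
    _ = ∑' i : κ × Fin n, ((∑' b, if i.2 = b then 0 else riesz s (x i) (x (i.1, b))) +
          (Fintype.card κ * n) * ∑' v, w v) := by
        refine tsum_congr fun i => ?_
        rw [ENNReal.tsum_add]
        congr 1
        · rw [ENNReal.tsum_prod', ENNReal.tsum_prod', tsum_eq_single i.1 fun k hk => by
            simp [Ne.symm hk]]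
          refine tsum_congr fun b => ?_
          simp
        · rw [ENNReal.tsum_prod']
          simp
    _ = ∑' k, familyEnergy s (fun a => x (k, a)) +
          (Fintype.card κ * n) * ((Fintype.card κ * n) * ∑' v, w v) := by
        rw [ENNReal.tsum_add]
        congr 1
        · rw [ENNReal.tsum_prod']
          simp only [familyEnergy_eq_tsum]
        · simp
    _ ≤ _ := by
        gcongr
        calc _ ≤ ∑' _k : κ, e := ENNReal.tsum_le_tsum he
          _ = _ := by simp

variable [DiscreteTopology Λ] [IsZLattice ℝ Λ]

-- The interior of a fundamental parallelepiped works: convexity makes its boundary null, and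
-- uniqueness of fractional parts separates its translates.
open MeasureTheory in
lemma exists_open_fundamental (hΛ : ZLattice.covolume Λ = 1) :
    ∃ U : Set (Space d), IsOpen U ∧ Bornology.IsBounded U ∧ volume U = 1 ∧
      ∀ v ∈ Λ, ∀ y ∈ U, y + v ∈ U → v = 0 := by
  let b := Module.Free.chooseBasis ℤ Λ
  let F := ZSpan.fundamentalDomain (b.ofZLatticeBasis ℝ)
  have hF : IsAddFundamentalDomain Λ F volume := ZLattice.isAddFundamentalDomain b volume
  have hFv : volume F = 1 := by
    have h := ZLattice.covolume_eq_measure_fundamentalDomain Λ volume hF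
    rw [hΛ, Measure.real, eq_comm, ENNReal.toReal_eq_one_iff] at h
    exact h
  have hconv : Convex ℝ F := by
    have : F = (b.ofZLatticeBasis ℝ).equivFun ⁻¹' (Set.univ.pi fun _ => Set.Ico (0 : ℝ) 1) := by
      ext y
      simp [F, ZSpan.mem_fundamentalDomain]
    rw [this]
    exact (convex_pi fun _ _ => convex_Ico 0 1).linear_preimage
      (b.ofZLatticeBasis ℝ).equivFun.toLinearMap
  refine ⟨interior F, isOpen_interior,
    (ZSpan.fundamentalDomain_isBounded _).subset interior_subset, ?_, ?_⟩
  · rw [← hFv]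
    exact measure_congr (interior_ae_eq_of_null_frontier (hconv.addHaar_frontier volume))
  · intro v hv y hy hyv
    have hv' : v ∈ Submodule.span ℤ (Set.range (b.ofZLatticeBasis ℝ)) := by
      rwa [b.ofZLatticeBasis_span ℝ]
    have h1 := (ZSpan.fract_eq_self (b := b.ofZLatticeBasis ℝ)).2 (interior_subset hy)
    have h2 := (ZSpan.fract_eq_self (b := b.ofZLatticeBasis ℝ)).2 (interior_subset hyv)
    rw [ZSpan.fract_add_ZSpan _ _ hv', h1] at h2
    simpa using h2

end Lattice

section Lattice

variable (Λ : Submodule ℤ (Space d)) [DiscreteTopology Λ] [IsZLattice ℝ Λ]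

/-- Points of shrunk cells stay at distance η from every nontrivial translate of another such point:
otherwise that translate would lie in a full cell, hence in U. Far away the distance is at least ‖v‖
- 2|ρ|. Together these give a bound c‖v‖, whose power -s is summable over Λ. -/
lemma exists_lattice_weight {s : ℝ} (hs : (d : ℝ) < s) {U : Set (Space d)}
    (hUb : Bornology.IsBounded U) (hU : ∀ v ∈ Λ, ∀ y ∈ U, y + v ∈ U → v = 0) {h δ : ℝ}
    (hh : 0 < h) (hδ : 0 < δ) (hδ1 : δ < 1) {κ : Finset (Fin d → ℤ)}
    (hκ : ∀ k ∈ κ, ∀ y ∈ cube d h, h • intPoint k + y ∈ U) :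
    ∃ w : Λ → ℝ≥0∞, ∑' v, w v < ⊤ ∧ ∀ k ∈ κ, ∀ k' ∈ κ, ∀ x ∈ cube d ((1 - δ) * h),
      ∀ y ∈ cube d ((1 - δ) * h),
        (k ≠ k' → riesz s (h • intPoint k + x) (h • intPoint k' + y) ≤ w 0) ∧
        ∀ v : Λ, v ≠ 0 → riesz s (h • intPoint k + x) (h • intPoint k' + y + (v : Space d)) ≤
          w v := by
  classical
  have hs0 : 0 < s := lt_of_le_of_lt (by positivity) hs
  obtain ⟨ρ, hρ⟩ := isBounded_iff_forall_norm_le.1 hUb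
  have hsmall : cube d ((1 - δ) * h) ⊆ cube d h := cube_mono (by nlinarith)
  set η : ℝ := δ * h / 2 with hη
  have hη0 : 0 < η := by positivity
  -- The largest constant with c‖v‖ ≤ max(η, ‖v‖ - 2|ρ|) for all values of ‖v‖; the two bounds cross
  -- at ‖v‖ = η + 2|ρ|.
  set c : ℝ := η / (η + 2 * |ρ|) with hc
  have hc0 : 0 < c := by positivity
  refine ⟨fun v => (if v = 0 then ENNReal.ofReal (δ * h) ^ (-s) else 0) +
    ENNReal.ofReal c ^ (-s) * (if v = 0 then 0 else ENNReal.ofReal ‖v‖ ^ (-s)), ?_, ?_⟩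
  · rw [ENNReal.tsum_add, tsum_ite_eq, ENNReal.tsum_mul_left]
    refine ENNReal.add_lt_top.2 ⟨?_, ENNReal.mul_lt_top ?_ (tsum_lattice_lt_top Λ (by simpa))⟩
    · rw [ENNReal.ofReal_rpow_of_pos (by positivity)]; exact ENNReal.ofReal_lt_top
    · rw [ENNReal.ofReal_rpow_of_pos hc0]; exact ENNReal.ofReal_lt_top
  intro k hk k' hk' x hx y hy
  refine ⟨fun hne => ?_, fun v hv => ?_⟩
  · simp only [if_true, mul_zero, add_zero]
    refine riesz_le hs0.le (le_trans ?_ (norm_sub_ge_of_cells hh.le hδ1.le hx hy k k' hne))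
    have : 1 ≤ ‖k - k'‖ := by
      obtain ⟨j, hj⟩ := Function.ne_iff.1 hne
      refine le_trans ?_ (norm_le_pi_norm (k - k') j)
      rw [Pi.sub_apply, Int.norm_eq_abs]
      exact_mod_cast Int.one_le_abs (sub_ne_zero.2 hj)
    nlinarith [mul_pos hδ hh]
  · simp only [hv, if_false, zero_add]
    have hvn : 0 < ‖v‖ := norm_pos_iff.2 hv
    rw [← ENNReal.mul_rpow_of_ne_zero (by simpa using hc0) (by simpa using hv),
      ← ENNReal.ofReal_mul hc0.le]
    refine riesz_le hs0.le ?_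
    set p := h • intPoint k + x with hp
    set q := h • intPoint k' + y with hq
    have hpU : p ∈ U := hκ k hk x (hsmall hx)
    have hqU : q ∈ U := hκ k' hk' y (hsmall hy)
    have h1 : η ≤ ‖p - (q + (v : Space d))‖ := by
      by_contra! hlt
      refine hv (Subtype.ext (hU v v.2 q hqU ?_))
      have h2 : x + (q + (v : Space d) - p) ∈ cube d h := by
        have := add_mem_cube hx (y := q + (v : Space d) - p) (r := η)
          (by rw [norm_sub_rev]; exact hlt.le)
        rwa [show (1 - δ) * h + 2 * η = h by rw [hη]; ring] at this
      have := hκ k hk _ h2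
      rwa [← add_assoc, ← hp, add_sub_cancel] at this
    have h2 : ‖v‖ - 2 * |ρ| ≤ ‖p - (q + (v : Space d))‖ := by
      have e1 : (v : Space d) = (p - q) - (p - (q + (v : Space d))) := by abel
      have e2 : ‖(v : Space d)‖ ≤ ‖p - q‖ + ‖p - (q + (v : Space d))‖ := by
        conv_lhs => rw [e1]
        exact norm_sub_le _ _
      have e3 : ‖p - q‖ ≤ |ρ| + |ρ| := (norm_sub_le _ _).trans
        (add_le_add ((hρ _ hpU).trans (le_abs_self ρ)) ((hρ _ hqU).trans (le_abs_self ρ)))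
      have e4 : ‖(v : Space d)‖ = ‖v‖ := rfl
      linarith
    have hpos : 0 < η + 2 * |ρ| := by positivity
    rw [hc, div_mul_eq_mul_div, div_le_iff₀ hpos]
    rcases le_total ‖v‖ (η + 2 * |ρ|) with hle | hle
    · nlinarith
    · nlinarith [abs_nonneg ρ]

/-- The infimum of the Riesz energy per period over the `Λ`-periodic families with `N` points per
period, rescaled. -/
def scaledPeriodicMinEnergy (s : ℝ) (N : ℕ) : ℝ≥0∞ :=
  ⨅ x : Fin N → Space d, periodicEnergy Λ s x / (N : ℝ≥0∞) ^ (1 + s / (d : ℝ))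

/-- The cells h, m and the interaction weight W depend on δ only, not on n or N; this allows n → ∞
with the geometry fixed. Surplus points, when N < mn, are discarded. -/
lemma exists_periodicEnergy_le (hΛ : ZLattice.covolume Λ = 1) {s : ℝ} (hs : (d : ℝ) < s) {δ : ℝ}
    (hδ : 0 < δ) (hδ1 : δ < 1) :
    ∃ (h : ℝ) (m : ℕ) (W : ℝ≥0∞), 0 < h ∧ W < ⊤ ∧
      ENNReal.ofReal (1 - δ) ≤ m * ENNReal.ofReal h ^ d ∧
      ∀ n N : ℕ, N ≤ m * n → ∃ x : Fin N → Space d, periodicEnergy Λ s x ≤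
        m * (ENNReal.ofReal ((1 - δ) * h) ^ (-s) * (minEnergy s (cube d 1) n + 1)) +
          (m * n) * ((m * n) * W) := by
  obtain ⟨U, hUo, hUb, hU1, hU⟩ := exists_open_fundamental Λ hΛ
  obtain ⟨h, κ, hh, hκ, hvol⟩ := exists_cells_in_open hUo (a := ENNReal.ofReal (1 - δ)) (by
    rw [hU1, ENNReal.ofReal_lt_one]; linarith)
  obtain ⟨w, hw, hw'⟩ := exists_lattice_weight Λ hs hUb hU hh hδ hδ1 hκ
  refine ⟨h, κ.card, ∑' v, w v, hh, hw, hvol, fun n N hN => ?_⟩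
  have ht : 0 < (1 - δ) * h := mul_pos (by linarith) hh
  obtain ⟨ω, hω, hE⟩ := exists_familyEnergy_le s ⟨0, zero_mem_cube zero_le_one⟩ (A := cube d 1) n
  have hmem : ∀ a, ((1 - δ) * h) • ω a ∈ cube d ((1 - δ) * h) := fun a => by
    rw [smul_mem_cube ht, div_self ht.ne']
    exact hω a
  let x : κ × Fin n → Space d := fun q =>
    h • intPoint (q.1 : Fin d → ℤ) + ((1 - δ) * h) • ω q.2
  have hcard : Fintype.card (κ × Fin n) = κ.card * n := by simp
  let f : Fin N → κ × Fin n := fun i => (Fintype.equivFinOfCardEq hcard).symm (Fin.castLE hN i)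
  have hf : Function.Injective f := (Equiv.injective _).comp (Fin.castLE_injective hN)
  refine ⟨x ∘ f, (periodicEnergy_comp_le Λ s x hf).trans ?_⟩
  refine (periodicEnergy_cells_le Λ x (w := w) (e := ENNReal.ofReal ((1 - δ) * h) ^ (-s) *
    (minEnergy s (cube d 1) n + 1)) (fun k => ?_) (fun k k' a b hk => ?_)
    fun i j v hv => ?_).trans (le_of_eq ?_)
  · simp only [x]
    rw [familyEnergy_const_add, familyEnergy_smul s _ ht]
    gcongr
  · exact (hw' k k.2 k' k'.2 _ (hmem a) _ (hmem b)).1 (fun h => hk (Subtype.ext h))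
  · exact (hw' i.1 i.1.2 j.1 j.1.2 _ (hmem _) _ (hmem _)).2 v hv
  · simp

/-- With n ≈ N/m points per cell the leading term is (1 - δ)^{-s} (m h^d)^{-s/d} times the constant,
and the cells fill volume m h^d ≥ 1 - δ. The interactions between cells are O(N²), hence negligible.
-/
lemma limsup_scaledPeriodicMinEnergy_le_mul (hd : 0 < d) (hΛ : ZLattice.covolume Λ = 1) {s : ℝ}
    (hs : (d : ℝ) < s) {δ : ℝ} (hδ : 0 < δ) (hδ1 : δ < 1) :
    limsup (scaledPeriodicMinEnergy Λ s) atTop ≤ ENNReal.ofReal (1 - δ) ^ (-s) *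
      ENNReal.ofReal (1 - δ) ^ (-(s / (d : ℝ))) * asymptoticMinEnergy d s := by
  have hd' : (0 : ℝ) < d := by exact_mod_cast hd
  have hs0 : 0 < s := hd'.trans hs
  have hp : 0 ≤ 1 + s / (d : ℝ) := by positivity
  obtain ⟨h, m, W, hh, hW, hvol, hx⟩ := exists_periodicEnergy_le Λ hΛ hs hδ hδ1
  have hm : 0 < m := by
    rcases Nat.eq_zero_or_pos m with rfl | hm
    · simp at hvol; linarith
    · exact hm
  have hme : (m : ℝ≥0∞) ≠ 0 := by exact_mod_cast hm.ne'
  have ht : 0 < (1 - δ) * h := mul_pos (by linarith) hh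
  set A : ℝ≥0∞ := ENNReal.ofReal ((1 - δ) * h) ^ (-s) with hA
  have hAt : A ≠ ⊤ := by rw [hA, ENNReal.ofReal_rpow_of_pos ht]; exact ENNReal.ofReal_ne_top
  set p : ℝ := 1 + s / (d : ℝ) with hpdef
  -- The + 1 guarantees N ≤ m · n N and does not affect the ratio n N / N → 1/m.
  let n : ℕ → ℕ := fun N => N / m + 1
  have hn : ∀ N, N ≤ m * n N := fun N => (Nat.lt_mul_div_succ N hm).le
  have hn0 : ∀ N, 0 < n N := fun N => Nat.succ_pos _
  have hntop : Tendsto n atTop atTop :=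
    tendsto_atTop_mono (fun N => Nat.le_succ (N / m)) (Nat.tendsto_div_const_atTop hm.ne')
  have hratio : Tendsto (fun N : ℕ => (n N : ℝ≥0∞) / N) atTop (𝓝 (m : ℝ≥0∞)⁻¹) := by
    have hlow : ∀ᶠ N : ℕ in atTop, (m : ℝ≥0∞)⁻¹ ≤ (n N : ℝ≥0∞) / N := by
      filter_upwards [eventually_gt_atTop 0] with N hN
      have hN' : (N : ℝ≥0∞) ≠ 0 := by exact_mod_cast hN.ne'
      rw [ENNReal.le_div_iff_mul_le (Or.inl hN') (Or.inl (by simp)), mul_comm, ← div_eq_mul_inv]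
      refine ENNReal.div_le_of_le_mul ?_
      rw [mul_comm]
      exact_mod_cast hn N
    have hup : ∀ᶠ N : ℕ in atTop, (n N : ℝ≥0∞) / N ≤ (m : ℝ≥0∞)⁻¹ + (N : ℝ≥0∞)⁻¹ := by
      filter_upwards [eventually_gt_atTop 0] with N hN
      have hN' : (N : ℝ≥0∞) ≠ 0 := by exact_mod_cast hN.ne'
      rw [ENNReal.div_le_iff hN' (by simp), add_mul, ENNReal.inv_mul_cancel hN' (by simp)]
      have h1 : ((N / m : ℕ) : ℝ≥0∞) ≤ (m : ℝ≥0∞)⁻¹ * N := by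
        rw [mul_comm, ← div_eq_mul_inv, ENNReal.le_div_iff_mul_le (Or.inl hme) (Or.inl (by simp))]
        exact_mod_cast Nat.div_mul_le_self N m
      simp only [n]
      push_cast
      gcongr
    have hlim : Tendsto (fun N : ℕ => (m : ℝ≥0∞)⁻¹ + (N : ℝ≥0∞)⁻¹) atTop (𝓝 (m : ℝ≥0∞)⁻¹) := by
      have := (ENNReal.tendsto_inv_nat_nhds_zero).const_add (m : ℝ≥0∞)⁻¹
      simpa using this
    exact tendsto_of_tendsto_of_tendsto_of_le_of_le' tendsto_const_nhds hlim hlow hup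
  have hbound : ∀ᶠ N : ℕ in atTop, scaledPeriodicMinEnergy Λ s N ≤
      m * A * (scaledMinEnergy d s (n N) * ((n N : ℝ≥0∞) / N) ^ p + 1 / (N : ℝ≥0∞) ^ p) +
      m * m * W * (((n N : ℝ≥0∞) / N) * ((n N : ℝ≥0∞) / N) * (N * N / (N : ℝ≥0∞) ^ p)) := by
    filter_upwards [eventually_gt_atTop 0] with N hN
    obtain ⟨x, hxE⟩ := hx (n N) N (hn N)
    have hN' : (N : ℝ≥0∞) ≠ 0 := by exact_mod_cast hN.ne'
    refine (iInf_le _ x).trans ?_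
    refine (ENNReal.div_le_div_right hxE _).trans (le_of_eq ?_)
    rw [minEnergy_eq_mul (hn0 N), ← hpdef, ENNReal.div_rpow_of_nonneg _ _ hp]
    have e1 : ((n N : ℝ≥0∞) / N) * ((n N : ℝ≥0∞) / N) * (N * N / (N : ℝ≥0∞) ^ p) =
        n N * n N / (N : ℝ≥0∞) ^ p := by
      calc _ = ((n N : ℝ≥0∞) / N * N) * ((n N : ℝ≥0∞) / N * N) / (N : ℝ≥0∞) ^ p := by
            simp only [div_eq_mul_inv]; ring
        _ = _ := by rw [ENNReal.div_mul_cancel hN' (by simp)]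
    rw [e1]
    simp only [div_eq_mul_inv]
    ring
  have hlim : Tendsto (fun N : ℕ =>
      m * A * (scaledMinEnergy d s (n N) * ((n N : ℝ≥0∞) / N) ^ p + 1 / (N : ℝ≥0∞) ^ p) +
      m * m * W * (((n N : ℝ≥0∞) / N) * ((n N : ℝ≥0∞) / N) * (N * N / (N : ℝ≥0∞) ^ p)))
      atTop (𝓝 (m * A * (asymptoticMinEnergy d s * (m : ℝ≥0∞)⁻¹ ^ p + 0) +
        m * m * W * ((m : ℝ≥0∞)⁻¹ * (m : ℝ≥0∞)⁻¹ * 0))) := by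
    have hC := (asymptoticMinEnergy_lt_top hd hs).ne
    have hi : (m : ℝ≥0∞)⁻¹ ≠ ⊤ := by simpa using hm.ne'
    have hip : (m : ℝ≥0∞)⁻¹ ^ p ≠ ⊤ := ENNReal.rpow_ne_top_of_nonneg hp hi
    have hr := ((ENNReal.continuous_rpow_const (y := p)).tendsto _).comp hratio
    refine Tendsto.add ?_ ?_
    · refine ENNReal.Tendsto.const_mul ?_ (Or.inr (ENNReal.mul_ne_top (by simp) hAt))
      exact (ENNReal.Tendsto.mul ((tendsto_scaledMinEnergy hd hs).comp hntop) (Or.inr hip) hr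
        (Or.inr hC)).add (tendsto_one_div_rpow hs0.le)
    · refine ENNReal.Tendsto.const_mul ?_
        (Or.inr (ENNReal.mul_ne_top (by finiteness) hW.ne))
      exact ENNReal.Tendsto.mul (ENNReal.Tendsto.mul hratio (Or.inr hi) hratio (Or.inr hi))
        (Or.inr (by simp)) (tendsto_mul_self_div_rpow hd hs)
        (Or.inr (ENNReal.mul_ne_top hi hi))
  refine (limsup_le_limsup hbound).trans ?_
  rw [hlim.limsup_eq]
  simp only [mul_zero, add_zero]
  have hδ0 : ENNReal.ofReal (1 - δ) ≠ 0 := by simpa using hδ1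
  have hh0 : ENNReal.ofReal h ≠ 0 := by simpa using hh
  have e1 : (m : ℝ≥0∞) * (m : ℝ≥0∞)⁻¹ ^ p = (m : ℝ≥0∞) ^ (-(s / (d : ℝ))) := by
    rw [ENNReal.inv_rpow, ← ENNReal.rpow_neg]
    nth_rewrite 1 [← ENNReal.rpow_one (m : ℝ≥0∞)]
    rw [← ENNReal.rpow_add _ _ hme (by simp)]
    congr 1
    rw [hpdef]; ring
  have e2 : ENNReal.ofReal h ^ (-s) = (ENNReal.ofReal h ^ d) ^ (-(s / (d : ℝ))) := by
    rw [← ENNReal.rpow_natCast, ← ENNReal.rpow_mul]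
    congr 1
    field_simp
  calc m * A * (asymptoticMinEnergy d s * (m : ℝ≥0∞)⁻¹ ^ p)
      = A * (m * (m : ℝ≥0∞)⁻¹ ^ p) * asymptoticMinEnergy d s := by ring
    _ = ENNReal.ofReal (1 - δ) ^ (-s) * (m * ENNReal.ofReal h ^ d) ^ (-(s / (d : ℝ))) *
          asymptoticMinEnergy d s := by
        rw [e1, hA, ENNReal.ofReal_mul (by linarith), ENNReal.mul_rpow_of_ne_zero hδ0 hh0, e2,
          ENNReal.mul_rpow_of_ne_zero hme (pow_ne_zero _ hh0)]
        ring
    _ ≤ _ := by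
        refine mul_le_mul' (mul_le_mul' le_rfl ?_) le_rfl
        exact rpow_neg_le_rpow_neg (div_nonneg hs0.le hd'.le) hvol

lemma limsup_scaledPeriodicMinEnergy_le (hd : 0 < d) (hΛ : ZLattice.covolume Λ = 1) {s : ℝ}
    (hs : (d : ℝ) < s) :
    limsup (scaledPeriodicMinEnergy Λ s) atTop ≤ asymptoticMinEnergy d s := by
  have hlim : Tendsto (fun δ : ℝ => ENNReal.ofReal (1 - δ) ^ (-s) *
      ENNReal.ofReal (1 - δ) ^ (-(s / (d : ℝ))) * asymptoticMinEnergy d s) (𝓝[>] 0)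
      (𝓝 (asymptoticMinEnergy d s)) := by
    have h1 : Tendsto (fun δ : ℝ => 1 - δ) (𝓝[>] 0) (𝓝 1) := by
      have : Tendsto (fun δ : ℝ => 1 - δ) (𝓝 0) (𝓝 (1 - 0)) := tendsto_id.const_sub 1
      rw [sub_zero] at this
      exact this.mono_left nhdsWithin_le_nhds
    have h3 : ∀ y : ℝ, Tendsto (fun δ : ℝ => ENNReal.ofReal (1 - δ) ^ y) (𝓝[>] 0) (𝓝 1) := by
      intro y
      have := ((ENNReal.continuous_rpow_const (y := y)).tendsto _).comp
        (ENNReal.tendsto_ofReal h1)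
      simpa [Function.comp_def] using this
    have h4 := ENNReal.Tendsto.mul (h3 (-s)) (Or.inr (by simp)) (h3 (-(s / (d : ℝ))))
      (Or.inr (by simp))
    have h5 := ENNReal.Tendsto.mul_const (b := asymptoticMinEnergy d s) h4
      (Or.inl (by simp))
    simpa using h5
  refine ge_of_tendsto hlim ?_
  filter_upwards [Ioo_mem_nhdsGT (zero_lt_one (α := ℝ))] with δ hδ
  exact limsup_scaledPeriodicMinEnergy_le_mul Λ hd hΛ hs hδ.1 hδ.2

end Lattice

/-! ### Nearly optimal periodic configurations of density 1 -/

section Lattice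

variable (Λ : Submodule ℤ (Space d)) [DiscreteTopology Λ] [IsZLattice ℝ Λ]

/-- Dilation by t = N^{1/d} spreads N points over a period of volume N, and turns the energy per
period into energy per volume through t^{-s-d} = N^{-(1+s/d)}. The term 1/N replaces attainment of
the infimum. -/
lemma exists_periodicConfig (hd : 0 < d) (hΛ : ZLattice.covolume Λ = 1) (s : ℝ) {N : ℕ}
    (hN : 0 < N) :
    ∃ C : Config d, C.HasUnitDensity ∧ C.IsPeriodic ((N : ℝ) ^ (1 / (d : ℝ))) Λ ∧
      limsup (fun R : ℝ => C.interaction s (cube d R) (cube d R) / ENNReal.ofReal R ^ d) atTop ≤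
        scaledPeriodicMinEnergy Λ s N + (N : ℝ≥0∞)⁻¹ := by
  have hN' : (0 : ℝ) < N := by exact_mod_cast hN
  have hNe : (N : ℝ≥0∞) ≠ 0 := by exact_mod_cast hN.ne'
  have hd' : (d : ℝ) ≠ 0 := by exact_mod_cast hd.ne'
  set t : ℝ := (N : ℝ) ^ (1 / (d : ℝ)) with htdef
  have ht : 0 < t := by positivity
  have htd : ENNReal.ofReal t ^ d = N := by
    rw [← ENNReal.ofReal_pow ht.le, htdef, ← Real.rpow_natCast, ← Real.rpow_mul hN'.le,
      one_div, inv_mul_cancel₀ hd', Real.rpow_one, ENNReal.ofReal_natCast]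
  have hts : ENNReal.ofReal t ^ (-s) * (ENNReal.ofReal t ^ d)⁻¹ =
      ((N : ℝ≥0∞) ^ (1 + s / (d : ℝ)))⁻¹ := by
    rw [htd, htdef, ← ENNReal.ofReal_rpow_of_pos hN', ENNReal.ofReal_natCast, ← ENNReal.rpow_mul,
      ← ENNReal.rpow_neg_one, ← ENNReal.rpow_neg, ← ENNReal.rpow_add _ _ hNe (by simp)]
    congr 1
    field_simp
    ring
  obtain ⟨x, hx⟩ : ∃ x : Fin N → Space d, periodicEnergy Λ s x / (N : ℝ≥0∞) ^ (1 + s / (d : ℝ)) ≤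
      scaledPeriodicMinEnergy Λ s N + (N : ℝ≥0∞)⁻¹ := by
    rcases eq_or_ne (scaledPeriodicMinEnergy Λ s N) ⊤ with h | h
    · exact ⟨0, by simp [h]⟩
    · obtain ⟨x, hx⟩ := iInf_lt_iff.1 (ENNReal.lt_add_right h
        (ENNReal.inv_ne_zero.2 (ENNReal.natCast_ne_top N)))
      exact ⟨x, hx.le⟩
  refine ⟨periodicConfig Λ ht x, ?_, periodicConfig_isPeriodic Λ ht x, ?_⟩
  · have := tendsto_count_periodicConfig Λ hΛ ht x
    rwa [htd, Fintype.card_fin, ENNReal.mul_inv_cancel hNe (by simp)] at this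
  · refine (limsup_interaction_periodicConfig_le Λ hΛ s ht x).trans ?_
    rw [hts, mul_comm, ← div_eq_mul_inv]
    exact hx

/-- The bound is on the limsup over R, stronger than one on `Config.energy`: the shell construction
needs control at all large radii. -/
theorem exists_periodic_sequence (hd : 0 < d) (hΛ : ZLattice.covolume Λ = 1) {s : ℝ}
    (hs : (d : ℝ) < s) :
    ∃ C : ℕ → Config d,
      (∀ N, 1 ≤ N → (C N).HasUnitDensity ∧ (C N).IsPeriodic ((N : ℝ) ^ (1 / (d : ℝ))) Λ) ∧
      ∀ a, asymptoticMinEnergy d s < a → ∀ᶠ N in atTop, limsup (fun R : ℝ =>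
        (C N).interaction s (cube d R) (cube d R) / ENNReal.ofReal R ^ d) atTop < a := by
  have h : ∀ N : ℕ, ∃ C : Config d, 1 ≤ N → C.HasUnitDensity ∧
      C.IsPeriodic ((N : ℝ) ^ (1 / (d : ℝ))) Λ ∧
      limsup (fun R : ℝ => C.interaction s (cube d R) (cube d R) / ENNReal.ofReal R ^ d) atTop ≤
        scaledPeriodicMinEnergy Λ s N + (N : ℝ≥0∞)⁻¹ := by
    intro N
    rcases Nat.eq_zero_or_pos N with rfl | hN
    · exact ⟨0, by simp⟩
    · obtain ⟨C, hC⟩ := exists_periodicConfig Λ hd hΛ s hN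
      exact ⟨C, fun _ => hC⟩
  choose C hC using h
  refine ⟨C, fun N hN => ⟨(hC N hN).1, (hC N hN).2.1⟩, fun a ha => ?_⟩
  obtain ⟨b, hb, hba⟩ := exists_between ha
  have h1 := eventually_lt_of_limsup_lt
    ((limsup_scaledPeriodicMinEnergy_le Λ hd hΛ hs).trans_lt hb)
  have h2 : ∀ᶠ N : ℕ in atTop, (N : ℝ≥0∞)⁻¹ < a - b :=
    ENNReal.tendsto_inv_nat_nhds_zero.eventually (gt_mem_nhds (tsub_pos_of_lt hba))
  filter_upwards [h1, h2, eventually_ge_atTop 1] with N hN1 hN2 hN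
  calc _ ≤ _ := (hC N hN).2.2
    _ < b + (a - b) := ENNReal.add_lt_add hN1 hN2
    _ = a := add_tsub_cancel_of_le hba.le

end Lattice

open MeasureTheory in
lemma exists_lattice_covolume_one (d : ℕ) :
    ∃ (Λ : Submodule ℤ (Space d)) (_ : DiscreteTopology Λ) (_ : IsZLattice ℝ Λ),
      ZLattice.covolume Λ = 1 := by
  let b := (EuclideanSpace.basisFun (Fin d) ℝ).toBasis
  refine ⟨Submodule.span ℤ (Set.range b), inferInstance, inferInstance, ?_⟩
  rw [ZLattice.covolume_eq_measure_fundamentalDomain _ volume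
    (ZSpan.isAddFundamentalDomain b volume), measureReal_congr
    (ZSpan.fundamentalDomain_ae_parallelepiped b volume), Measure.real]
  simp only [b, OrthonormalBasis.coe_toBasis]
  rw [OrthonormalBasis.volume_parallelepiped, ENNReal.toReal_one]

theorem exists_nearly_optimal (hd : 0 < d) {s : ℝ} (hs : (d : ℝ) < s) {a : ℝ≥0∞}
    (ha : asymptoticMinEnergy d s < a) :
    ∃ C : Config d, C.HasUnitDensity ∧ limsup (fun R : ℝ =>
      C.interaction s (cube d R) (cube d R) / ENNReal.ofReal R ^ d) atTop < a := by
  obtain ⟨Λ, _, _, hΛ⟩ := exists_lattice_covolume_one d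
  obtain ⟨C, hC, hE⟩ := exists_periodic_sequence Λ hd hΛ hs
  obtain ⟨N, hN, hN1⟩ := ((hE a ha).and (eventually_ge_atTop 1)).exists
  exact ⟨C N, (hC N hN1).1, hN⟩

/-! ### Gluing configurations in shells -/

lemma Config.count_eq_tsum (C : Config d) (A : Set (Space d)) :
    C.count A = ∑' p, A.indicator (fun p => (C p : ℝ≥0∞)) p :=
  tsum_subtype A fun p => (C p : ℝ≥0∞)

lemma Config.interaction_eq_tsum (s : ℝ) (C : Config d) (A B : Set (Space d)) :
    C.interaction s A B = ∑' p, ∑' q,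
      A.indicator 1 p * (B.indicator 1 q * ((C.pairs p q : ℝ≥0∞) * riesz s p q)) := by
  rw [Config.interaction,
    tsum_subtype A fun p => ∑' q : B, (C.pairs p q : ℝ≥0∞) * riesz s p (q : Space d)]
  refine tsum_congr fun p => ?_
  rw [ENNReal.tsum_mul_left]
  by_cases hp : p ∈ A
  · rw [Set.indicator_of_mem hp, Set.indicator_of_mem hp, tsum_subtype B fun q => (C.pairs p q : ℝ≥0∞) * riesz s p q, Pi.one_apply, one_mul]
    refine tsum_congr fun q => ?_
    by_cases hq : q ∈ B <;> simp [hq]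
  · simp [hp]

lemma Config.count_cube_ne_top (C : Config d) (R : ℝ) : C.count (cube d R) ≠ ⊤ := by
  rcases le_or_gt R 0 with hR | hR
  · refine ne_top_of_le_ne_top (b := C.count (cube d 1)) ?_ ?_
    · obtain ⟨n, hn, -⟩ := C.exists_minEnergy_le_interaction 0 one_pos
      simp [hn]
    · exact ENNReal.tsum_mono_subtype (fun p => (C p : ℝ≥0∞)) (cube_mono (by linarith))
  · obtain ⟨n, hn, -⟩ := C.exists_minEnergy_le_interaction 0 hR
    simp [hn]

/-- The number of points of `C` in the cube `K_R`. -/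
def Config.num (C : Config d) (R : ℝ) : ℝ := (C.count (cube d R)).toReal

lemma Config.ofReal_num (C : Config d) (R : ℝ) : ENNReal.ofReal (C.num R) = C.count (cube d R) :=
  ENNReal.ofReal_toReal (C.count_cube_ne_top R)

lemma Config.HasUnitDensity.tendsto_num {C : Config d} (h : C.HasUnitDensity) :
    Tendsto (fun R => C.num R / R ^ d) atTop (𝓝 1) := by
  have h1 := (ENNReal.tendsto_toReal ENNReal.one_ne_top).comp h
  rw [ENNReal.toReal_one] at h1
  refine h1.congr' ?_
  filter_upwards [eventually_ge_atTop 0] with R hR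
  simp [Config.num, ENNReal.toReal_div, ENNReal.toReal_ofReal hR]

lemma Config.HasUnitDensity.eventually_num {C : Config d} (h : C.HasUnitDensity) {ε : ℝ}
    (hε : 0 < ε) :
    ∀ᶠ R in atTop, (1 - ε) * R ^ d ≤ C.num R ∧ C.num R ≤ (1 + ε) * R ^ d := by
  filter_upwards [h.tendsto_num.eventually (Icc_mem_nhds (a := 1 - ε) (b := 1 + ε) (by linarith)
    (by linarith)), eventually_gt_atTop 0] with R hR hR0
  rw [le_div_iff₀ (by positivity), div_le_iff₀ (by positivity)] at hR
  exact hR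

/-- The configuration obtained by filling the cubic shell `K_{R (j + 1)} \ K_{r j}` with the points
of `D j`, for every `j`. -/
lemma exists_shellConfig (D : ℕ → Config d) {R r : ℕ → ℝ} (hRtop : Tendsto R atTop atTop)
    (hR : Monotone R) :
    ∃ C : Config d, (∀ p ∈ cube d (R 0), C p = 0) ∧
      (∀ j, ∀ p ∈ cube d (R (j + 1)), p ∉ cube d (R j) → p ∈ cube d (r j) → C p = 0) ∧
      ∀ j, ∀ p ∈ cube d (R (j + 1)), p ∉ cube d (R j) → p ∉ cube d (r j) → C p = D j p := by
  classical
  have hex : ∀ p : Space d, ∃ j, p ∈ cube d (R j) := fun p => by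
    obtain ⟨j, hj⟩ := (hRtop.eventually_ge_atTop (2 * ‖p‖)).exists
    exact ⟨j, fun i => by
      have := PiLp.norm_apply_le p i
      rw [Real.norm_eq_abs] at this
      linarith⟩
  -- `Nat.find` gives the first cube K_{R j} containing p; first cube j + 1 means that p lies in
  -- shell j.
  let f : Space d → ℕ := fun p => match Nat.find (hex p) with
    | 0 => 0
    | j + 1 => if p ∈ cube d (r j) then 0 else D j p
  have hf0 : ∀ p ∈ cube d (R 0), f p = 0 := fun p hp => by
    have : Nat.find (hex p) = 0 := (Nat.find_eq_zero _).2 hp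
    simp only [f, this]
  have hfj : ∀ j, ∀ p ∈ cube d (R (j + 1)), p ∉ cube d (R j) →
      f p = if p ∈ cube d (r j) then 0 else D j p := fun j p hp hp' => by
    have : Nat.find (hex p) = j + 1 := by
      rw [Nat.find_eq_iff]
      exact ⟨hp, fun n hn hpn => hp' (cube_mono (hR (Nat.lt_succ_iff.1 hn)) hpn)⟩
    simp only [f, this]
  refine ⟨⟨f, Set.subset_univ _, fun z _ => ?_⟩, hf0, fun j p h1 h2 h3 => ?_,
    fun j p h1 h2 h3 => ?_⟩
  -- A unit ball lies in a single K_{R J}, so only D_0, …, D_{J-1} contribute to it.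
  · obtain ⟨J, hJ⟩ := (hRtop.eventually_ge_atTop (2 * (‖z‖ + 1))).exists
    refine ⟨Metric.ball z 1, Metric.ball_mem_nhds z one_pos,
      ((Finset.range J).finite_toSet.biUnion fun j _ =>
        (D j).finite_inter_support (isBounded_cube (R J))).subset ?_⟩
    rintro p ⟨hp, hfp⟩
    have hpJ : p ∈ cube d (R J) := fun i => by
      have h1 := PiLp.norm_apply_le p i
      rw [Real.norm_eq_abs] at h1
      have h2 : ‖p‖ ≤ ‖z‖ + 1 := by
        have h3 : ‖p - z‖ < 1 := by rwa [← dist_eq_norm]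
        linarith [norm_le_norm_add_norm_sub' p z]
      linarith
    have hle : Nat.find (hex p) ≤ J := Nat.find_min' _ hpJ
    rcases hk : Nat.find (hex p) with _ | j
    · exact absurd (by simp only [f, hk]) hfp
    · refine Set.mem_biUnion (x := j) (by simp; omega) ⟨hpJ, fun h0 => hfp ?_⟩
      simp only [f, hk, h0, ite_self]
  · exact (hfj j p h1 h2).trans (if_pos h3)
  · exact (hfj j p h1 h2).trans (if_neg h3)

section Shell

variable {C D : Config d} {R₀ R₁ r : ℝ}

lemma count_shell_le (h0 : ∀ p ∈ cube d R₁, p ∉ cube d R₀ → p ∈ cube d r → C p = 0)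
    (h1 : ∀ p ∈ cube d R₁, p ∉ cube d R₀ → p ∉ cube d r → C p = D p) {R : ℝ} (hR : R ≤ R₁) :
    C.num R ≤ C.num R₀ + D.num R := by
  rw [Config.num, Config.num, Config.num,
    ← ENNReal.toReal_add (C.count_cube_ne_top _) (D.count_cube_ne_top _)]
  refine ENNReal.toReal_mono (ENNReal.add_ne_top.2
    ⟨C.count_cube_ne_top _, D.count_cube_ne_top _⟩) ?_
  simp only [Config.count_eq_tsum]
  rw [← ENNReal.tsum_add]
  refine ENNReal.tsum_le_tsum fun p => ?_
  by_cases hp : p ∈ cube d R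
  · by_cases hp0 : p ∈ cube d R₀
    · simp [hp, hp0]
    · by_cases hpr : p ∈ cube d r
      · simp [hp, h0 p (cube_mono hR hp) hp0 hpr]
      · simp [hp, hp0, h1 p (cube_mono hR hp) hp0 hpr]
  · simp [hp]

/-- Relative to D, the points lost outside K_{R₀} lie in K_r; allowing all D-points of K_r also
covers those replaced inside K_{R₀}. -/
lemma le_count_shell
    (h1 : ∀ p ∈ cube d R₁, p ∉ cube d R₀ → p ∉ cube d r → C p = D p) (hr : R₀ ≤ r) {R : ℝ}
    (hR₀ : R₀ ≤ R) (hR : R ≤ R₁) :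
    C.num R₀ + D.num R ≤ C.num R + D.num r := by
  rw [Config.num, Config.num, Config.num, Config.num,
    ← ENNReal.toReal_add (C.count_cube_ne_top _) (D.count_cube_ne_top _),
    ← ENNReal.toReal_add (C.count_cube_ne_top _) (D.count_cube_ne_top _)]
  refine ENNReal.toReal_mono (ENNReal.add_ne_top.2
    ⟨C.count_cube_ne_top _, D.count_cube_ne_top _⟩) ?_
  simp only [Config.count_eq_tsum]
  rw [← ENNReal.tsum_add, ← ENNReal.tsum_add]
  refine ENNReal.tsum_le_tsum fun p => ?_
  by_cases hp : p ∈ cube d R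
  · by_cases hp0 : p ∈ cube d R₀
    · simp [hp, hp0, cube_mono hr hp0]
    · by_cases hpr : p ∈ cube d r
      · simp [hp, hp0, hpr]
      · simp [hp, hp0, hpr, h1 p (cube_mono hR hp) hp0 hpr]
  · have hp0 : p ∉ cube d R₀ := fun h => hp (cube_mono hR₀ h)
    simp [hp, hp0]

lemma riesz_le_of_mem_cube {s : ℝ} (hs : 0 ≤ s) {p q : Space d} (hp : p ∈ cube d R₀)
    (hq : q ∉ cube d r) : riesz s p q ≤ ENNReal.ofReal ((r - R₀) / 2) ^ (-s) := by
  refine riesz_le hs ?_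
  rw [mem_cube, not_forall] at hq
  obtain ⟨i, hi⟩ := hq
  refine le_trans ?_ (PiLp.norm_apply_le (p - q) i)
  rw [PiLp.sub_apply, Real.norm_eq_abs]
  have h1 := abs_sub_abs_le_abs_sub (q i) (p i)
  rw [abs_sub_comm (q i)] at h1
  have := hp i
  push Not at hi
  linarith

/-- No particle sits in the gap, so inner and outer particles are at least (r - R₀)/2 apart; the
factor 2 counts ordered pairs. -/
lemma interaction_shell_le {s : ℝ} (hs : 0 ≤ s)
    (h0 : ∀ p ∈ cube d R₁, p ∉ cube d R₀ → p ∈ cube d r → C p = 0)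
    (h1 : ∀ p ∈ cube d R₁, p ∉ cube d R₀ → p ∉ cube d r → C p = D p) :
    C.interaction s (cube d R₁) (cube d R₁) ≤ C.interaction s (cube d R₀) (cube d R₀) +
      D.interaction s (cube d R₁) (cube d R₁) + 2 * (C.count (cube d R₀) * D.count (cube d R₁) *
        ENNReal.ofReal ((r - R₀) / 2) ^ (-s)) := by
  set g := ENNReal.ofReal ((r - R₀) / 2) ^ (-s) with hg
  set A := cube d R₁
  set B := cube d R₀
  set u : Space d → ℝ≥0∞ := B.indicator fun p => (C p : ℝ≥0∞) with hu
  set v : Space d → ℝ≥0∞ := A.indicator fun p => (D p : ℝ≥0∞) with hv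
  have hcross1 : ∑' p, ∑' q, u p * v q * g = C.count B * D.count A * g := by
    simp_rw [mul_assoc, ENNReal.tsum_mul_left, ENNReal.tsum_mul_right]
    rw [Config.count_eq_tsum, Config.count_eq_tsum]
  have hcross2 : ∑' p, ∑' q, u q * v p * g = C.count B * D.count A * g := by
    rw [ENNReal.tsum_comm, hcross1]
  rw [two_mul]
  nth_rewrite 1 [← hcross1]
  rw [← hcross2]
  simp only [Config.interaction_eq_tsum]
  simp only [← ENNReal.tsum_add]
  refine ENNReal.tsum_le_tsum fun p => ENNReal.tsum_le_tsum fun q => ?_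
  by_cases hp : p ∈ A
  swap
  · simp [hp]
  by_cases hq : q ∈ A
  swap
  · simp [hq]
  simp only [hp, hq, Set.indicator_of_mem, Pi.one_apply, one_mul]
  by_cases hC : C p = 0 ∨ C q = 0
  · have : C.pairs p q = 0 := by
      rw [Config.pairs]
      split_ifs with h
      · subst h; simp [hC.elim id id]
      · rcases hC with h | h <;> simp [h]
    simp [this]
  rw [not_or] at hC
  by_cases hpB : p ∈ B <;> by_cases hqB : q ∈ B
  · refine le_trans ?_ le_self_add
    refine le_trans ?_ le_self_add
    simp [hpB, hqB]
  · have hqr : q ∉ cube d r := fun h => hC.2 (h0 q hq hqB h)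
    have hpq : p ≠ q := fun h => hqB (h ▸ hpB)
    refine le_trans ?_ le_add_self
    refine le_trans ?_ le_self_add
    simp only [hu, hv, hpB, hq, Set.indicator_of_mem, Config.pairs, if_neg hpq,
      ← h1 q hq hqB hqr]
    push_cast
    gcongr
    exact riesz_le_of_mem_cube hs hpB hqr
  · have hpr : p ∉ cube d r := fun h => hC.1 (h0 p hp hpB h)
    have hpq : p ≠ q := fun h => hpB (h ▸ hqB)
    refine le_trans ?_ le_add_self
    refine le_trans ?_ le_add_self
    simp only [hu, hv, hqB, hp, Set.indicator_of_mem, Config.pairs, if_neg hpq,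
      ← h1 p hp hpB hpr]
    push_cast
    rw [mul_comm (C q : ℝ≥0∞)]
    gcongr
    rw [riesz_comm]
    exact riesz_le_of_mem_cube hs hqB hpr
  · have hqr : q ∉ cube d r := fun h => hC.2 (h0 q hq hqB h)
    have hpr : p ∉ cube d r := fun h => hC.1 (h0 p hp hpB h)
    refine le_trans ?_ le_self_add
    refine le_trans ?_ le_add_self
    rw [Config.pairs, Config.pairs, h1 p hp hpB hpr, h1 q hq hqB hqr]

end Shell

/-- The unbounded ratio j + 3 makes the previous cube a vanishing fraction of the next, and T j lets
R j be as large as D_j requires. -/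
lemma exists_growing_radii (T : ℕ → ℝ) :
    ∃ R : ℕ → ℝ, (∀ j, T j ≤ R j) ∧ (∀ j : ℕ, (j : ℝ) + 1 ≤ R j) ∧
      ∀ j : ℕ, ((j : ℝ) + 3) * R j ≤ R (j + 1) := by
  let R : ℕ → ℝ := fun j =>
    Nat.rec (max 1 (T 0)) (fun j Rj => max (T (j + 1)) (((j : ℝ) + 3) * Rj)) j
  have hstep : ∀ j : ℕ, ((j : ℝ) + 3) * R j ≤ R (j + 1) := fun j => le_max_right _ _
  refine ⟨R, fun j => ?_, fun j => ?_, hstep⟩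
  · cases j with
    | zero => exact le_max_right _ _
    | succ j => exact le_max_left _ _
  · induction j with
    | zero =>
      have : (1 : ℝ) ≤ R 0 := le_max_left _ _
      simpa using this
    | succ j ih =>
      have := hstep j
      have hj : (0 : ℝ) ≤ j := by positivity
      push_cast
      nlinarith

lemma add_three_mul_pow_le (hd : 0 < d) {j : ℕ} {x y : ℝ} (hx : 0 ≤ x)
    (h : ((j : ℝ) + 3) * x ≤ y) : ((j : ℝ) + 3) * x ^ d ≤ y ^ d := by
  have h1 : (1 : ℝ) ≤ (j : ℝ) + 3 := by linarith [Nat.cast_nonneg (α := ℝ) j]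
  calc ((j : ℝ) + 3) * x ^ d ≤ ((j : ℝ) + 3) ^ d * x ^ d := by
        gcongr
        exact le_self_pow₀ h1 hd.ne'
    _ = (((j : ℝ) + 3) * x) ^ d := (mul_pow _ _ _).symm
    _ ≤ _ := by gcongr

/-- This makes the interaction across a gap of width proportional to ηR negligible, again by s > d.
The 6 is the product of the count bounds 3 and 2 on either side of the gap. -/
lemma eventually_ofReal_rpow_mul_le {s : ℝ} (hs : (d : ℝ) < s) {η : ℝ} (hη : 0 < η) :
    ∀ᶠ R : ℝ in atTop,
      ENNReal.ofReal (6 * R ^ d) * ENNReal.ofReal (η * R / 2) ^ (-s) ≤ ENNReal.ofReal η := by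
  have h1 : Tendsto (fun R : ℝ => 6 * (η / 2) ^ (-s) * R ^ (-(s - d))) atTop (𝓝 0) := by
    simpa using (tendsto_rpow_neg_atTop (sub_pos.2 hs)).const_mul (6 * (η / 2) ^ (-s))
  filter_upwards [h1.eventually (gt_mem_nhds hη), eventually_gt_atTop 0] with R hR hR0
  rw [ENNReal.ofReal_rpow_of_pos (by positivity), ← ENNReal.ofReal_mul (by positivity)]
  refine ENNReal.ofReal_le_ofReal (le_trans (le_of_eq ?_) hR.le)
  rw [mul_div_right_comm, Real.mul_rpow (by positivity) hR0.le, neg_sub,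
    sub_eq_add_neg, Real.rpow_add hR0, Real.rpow_natCast]
  ring

/-- Density of a configuration made of shells filled with configurations of unit density. -/
lemma num_bounds_of_shells {C : Config d} {D : ℕ → Config d} {R η : ℕ → ℝ} (hd : 0 < d)
    (hη0 : ∀ j, 0 < η j) (hη1 : ∀ j, η j ≤ 1) (hR1 : ∀ j : ℕ, (j : ℝ) + 1 ≤ R j)
    (hstep : ∀ j : ℕ, ((j : ℝ) + 3) * R j ≤ R (j + 1))
    (hnum : ∀ j x, R j ≤ x →
      (1 - η j) * x ^ d ≤ (D j).num x ∧ (D j).num x ≤ (1 + η j) * x ^ d)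
    (hC0 : C.num (R 0) = 0)
    (hup : ∀ j x, x ≤ R (j + 1) → C.num x ≤ C.num (R j) + (D j).num x)
    (hlow : ∀ j x, R j ≤ x → x ≤ R (j + 1) →
      C.num (R j) + (D j).num x ≤ C.num x + (D j).num ((1 + η j) * R j)) :
    (∀ j, C.num (R j) ≤ 3 * R j ^ d) ∧
    (∀ j : ℕ, C.num (R (j + 1)) ≤ (1 + (η j + 3 / ((j : ℝ) + 3))) * R (j + 1) ^ d) ∧
    (∀ j : ℕ, ∀ x, R (j + 1) ≤ x → x ≤ R (j + 2) →
      (1 - (η (j + 1) + ((1 + η (j + 1)) ^ (d + 1) - 1 + η j + 2 ^ (d + 1) / ((j : ℝ) + 3)))) *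
        x ^ d ≤ C.num x) := by
  have hRpos : ∀ j, 0 < R j := fun j => lt_of_lt_of_le (by positivity) (hR1 j)
  have hpow : ∀ j : ℕ, ((j : ℝ) + 3) * R j ^ d ≤ R (j + 1) ^ d := fun j =>
    add_three_mul_pow_le hd (hRpos j).le (hstep j)
  have hpow' : ∀ j : ℕ, R j ^ d ≤ R (j + 1) ^ d / ((j : ℝ) + 3) := fun j => by
    rw [le_div_iff₀ (by positivity), mul_comm]
    exact hpow j
  have hRpow : ∀ j, 0 < R j ^ d := fun j => pow_pos (hRpos j) d
  have hle : ∀ j, R j ≤ R (j + 1) := fun j => by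
    have := hstep j
    have hj : (0 : ℝ) ≤ j := by positivity
    nlinarith [hRpos j]
  -- The constant 3 propagates: 3 R_j^d + 2 R_{j+1}^d ≤ (3/(j + 3) + 2) R_{j+1}^d ≤ 3 R_{j+1}^d.
  have h3 : ∀ j, C.num (R j) ≤ 3 * R j ^ d := by
    intro j
    induction j with
    | zero => rw [hC0]; exact mul_nonneg (by norm_num) (hRpow 0).le
    | succ j ih =>
      have e1 := hup j (R (j + 1)) le_rfl
      have e2 := (hnum j (R (j + 1)) (hle j)).2
      have e3 := hpow j
      have hj : (0 : ℝ) ≤ j := by positivity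
      nlinarith [hη1 j, hRpow j, hRpow (j + 1), mul_nonneg hj (hRpow j).le]
  refine ⟨h3, fun j => ?_, fun j x hx hx' => ?_⟩
  · have e1 := hup j (R (j + 1)) le_rfl
    have e2 := (hnum j (R (j + 1)) (hle j)).2
    have e3 := h3 j
    have e4 := hpow' j
    have e5 : 3 / ((j : ℝ) + 3) * R (j + 1) ^ d = 3 * (R (j + 1) ^ d / ((j : ℝ) + 3)) := by ring
    rw [add_mul, add_mul, e5]
    linarith
  · have hx0 : 0 < x := (hRpos _).trans_le hx
    have inner : ∀ j, R j ≤ (1 + η j) * R j := fun j => by nlinarith [hη0 j, hRpos j]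
    have f1 := hlow (j + 1) x hx hx'
    have f2 := (hnum (j + 1) x hx).1
    have f3 := (hnum (j + 1) _ (inner (j + 1))).2
    -- Just outside R_{j+1} the points come mostly from the previous shell, so the lower bound there
    -- is needed as well.
    have g1 := hlow j (R (j + 1)) (hle j) le_rfl
    have g2 := (hnum j (R (j + 1)) (hle j)).1
    have g3 := (hnum j _ (inner j)).2
    have g0 : 0 ≤ C.num (R j) := ENNReal.toReal_nonneg
    have g4 : (1 + η j) * ((1 + η j) * R j) ^ d ≤ 2 ^ (d + 1) * (R (j + 1) ^ d / ((j : ℝ) + 3)) := by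
      rw [mul_pow, ← mul_assoc, ← pow_succ']
      have := hη0 j
      have := hRpow j
      gcongr
      · linarith [hη1 j]
      · exact hpow' j
    have f4 : (1 + η (j + 1)) * ((1 + η (j + 1)) * R (j + 1)) ^ d =
        (1 + η (j + 1)) ^ (d + 1) * R (j + 1) ^ d := by
      rw [mul_pow, ← mul_assoc, ← pow_succ']
    rw [f4] at f3
    set y := (1 + η (j + 1)) ^ (d + 1) - 1 + η j + 2 ^ (d + 1) / ((j : ℝ) + 3) with hy
    have hy0 : 0 ≤ y := by
      have h1 : 1 ≤ (1 + η (j + 1)) ^ (d + 1) := one_le_pow₀ (by linarith [hη0 (j + 1)])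
      have h2 : 0 ≤ 2 ^ (d + 1) / ((j : ℝ) + 3) := by positivity
      linarith [hη0 j]
    have hmono : y * R (j + 1) ^ d ≤ y * x ^ d := by
      have := (hRpos (j + 1)).le
      gcongr
    have e : y * R (j + 1) ^ d = (1 + η (j + 1)) ^ (d + 1) * R (j + 1) ^ d -
        (1 - η j) * R (j + 1) ^ d + 2 ^ (d + 1) * (R (j + 1) ^ d / ((j : ℝ) + 3)) := by
      rw [hy]; ring
    have e' : (1 - (η (j + 1) + y)) * x ^ d = (1 - η (j + 1)) * x ^ d - y * x ^ d := by ring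
    rw [e']
    linarith

/-- As the density is a liminf, the upper bound is needed only along the radii R_{j+1}, the lower
bound at every large radius. -/
lemma density_eq_one_of_num {C : Config d} {R u l : ℕ → ℝ} (hRtop : Tendsto R atTop atTop)
    (hu : Tendsto u atTop (𝓝 0)) (hl : Tendsto l atTop (𝓝 0))
    (hup : ∀ j, C.num (R (j + 1)) ≤ (1 + u j) * R (j + 1) ^ d)
    (hlow : ∀ j x, R (j + 1) ≤ x → x ≤ R (j + 2) → (1 - l j) * x ^ d ≤ C.num x) :
    C.density = 1 := by
  have hR1 : Tendsto (fun j => R (j + 1)) atTop atTop := hRtop.comp (tendsto_add_atTop_nat 1)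
  refine le_antisymm ?_ ?_
  · refine le_of_forall_gt_imp_ge_of_dense fun a ha => ?_
    rcases eq_or_ne a ⊤ with rfl | hat
    · exact le_top
    refine liminf_le_of_frequently_le (hR1.frequently (Eventually.frequently ?_))
      (by isBoundedDefault)
    have ha' : 0 < a.toReal - 1 := by
      rw [sub_pos, ← ENNReal.toReal_one]
      exact ENNReal.toReal_strict_mono hat ha
    filter_upwards [hu.eventually (gt_mem_nhds ha'), hR1.eventually_gt_atTop 0] with j hj hj0
    rw [ENNReal.div_le_iff (pow_ne_zero _ (by simpa using hj0)) (by finiteness),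
      ← C.ofReal_num, ← ENNReal.ofReal_toReal hat, ← ENNReal.ofReal_pow hj0.le,
      ← ENNReal.ofReal_mul ENNReal.toReal_nonneg]
    refine ENNReal.ofReal_le_ofReal ((hup j).trans ?_)
    gcongr
    linarith
  · refine le_of_forall_lt_imp_le_of_dense fun a ha => ?_
    have hat : a ≠ ⊤ := ha.ne_top
    refine le_liminf_of_le (by isBoundedDefault) ?_
    have ha' : 0 < 1 - a.toReal := by
      rw [sub_pos, ← ENNReal.toReal_one]
      exact ENNReal.toReal_strict_mono ENNReal.one_ne_top ha
    obtain ⟨J, hJ⟩ := eventually_atTop.1 (hl.eventually (gt_mem_nhds ha'))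
    have hmax : ∃ x₀, ∀ k ≤ J + 1, R k ≤ x₀ := by
      obtain ⟨x₀, hx₀⟩ := ((Finset.range (J + 2)).image R).bddAbove
      exact ⟨x₀, fun k hk => hx₀ (by
        simp only [Finset.coe_image, Set.mem_image, Finset.mem_coe, Finset.mem_range]
        exact ⟨k, by omega, rfl⟩)⟩
    obtain ⟨x₀, hx₀⟩ := hmax
    filter_upwards [eventually_gt_atTop 0, eventually_ge_atTop x₀] with x hx0 hx
    classical
    have hex : ∃ k, x < R k := (hRtop.eventually_gt_atTop x).exists
    obtain ⟨j, hj⟩ : ∃ j, Nat.find hex = j + 2 ∧ J ≤ j := by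
      have : J + 1 < Nat.find hex := by
        by_contra! h
        exact absurd (Nat.find_spec hex) (not_lt.2 ((hx₀ _ h).trans hx))
      exact ⟨Nat.find hex - 2, by omega, by omega⟩
    have hxu : x ≤ R (j + 2) := by rw [← hj.1]; exact (Nat.find_spec hex).le
    have hxl : R (j + 1) ≤ x := not_lt.1 (Nat.find_min hex (by omega))
    rw [ENNReal.le_div_iff_mul_le (Or.inl (pow_ne_zero _ (by simpa using hx0)))
      (Or.inl (by finiteness)), ← C.ofReal_num, ← ENNReal.ofReal_toReal hat,
      ← ENNReal.ofReal_pow hx0.le, ← ENNReal.ofReal_mul ENNReal.toReal_nonneg]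
    refine ENNReal.ofReal_le_ofReal (le_trans ?_ (hlow j x hxl hxu))
    have := hJ j hj.2
    gcongr
    linarith

/-- The energy is a liminf, so sampling at the R_{j+1} is enough. An a priori bound of order R_j^d
shows that the inner energy is O(1/j) of R_{j+1}^d, and only c survives. -/
lemma energy_le_of_recursion {C : Config d} {s : ℝ} {R : ℕ → ℝ} {η : ℕ → ℝ} {c : ℝ≥0∞}
    (hc : c ≠ ⊤) (hη : Tendsto η atTop (𝓝 0)) (hη1 : ∀ j, η j ≤ 1)
    (hRpos : ∀ j, 0 < R j) (hRtop : Tendsto R atTop atTop)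
    (hpow : ∀ j : ℕ, ((j : ℝ) + 3) * R j ^ d ≤ R (j + 1) ^ d)
    (h0 : C.interaction s (cube d (R 0)) (cube d (R 0)) = 0)
    (hstep : ∀ j, C.interaction s (cube d (R (j + 1))) (cube d (R (j + 1))) ≤
      C.interaction s (cube d (R j)) (cube d (R j)) +
        (c + 3 * ENNReal.ofReal (η j)) * ENNReal.ofReal (R (j + 1)) ^ d) :
    C.energy s ≤ c := by
  have hpowE : ∀ j : ℕ, ((j + 3 : ℕ) : ℝ≥0∞) * ENNReal.ofReal (R j) ^ d ≤
      ENNReal.ofReal (R (j + 1)) ^ d := fun j => by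
    rw [← ENNReal.ofReal_pow (hRpos _).le, ← ENNReal.ofReal_pow (hRpos _).le,
      ← ENNReal.ofReal_natCast, ← ENNReal.ofReal_mul (by positivity)]
    refine ENNReal.ofReal_le_ofReal ?_
    have := hpow j
    push_cast
    exact this
  have hη1' : ∀ j, ENNReal.ofReal (η j) ≤ 1 := fun j => ENNReal.ofReal_le_one.2 (hη1 j)
  have hM : ∀ j, C.interaction s (cube d (R j)) (cube d (R j)) ≤
      2 * (c + 3) * ENNReal.ofReal (R j) ^ d := by
    intro j
    induction j with
    | zero => simp [h0]
    | succ j ih =>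
      have h2 : 2 * ENNReal.ofReal (R j) ^ d ≤ ENNReal.ofReal (R (j + 1)) ^ d := by
        refine le_trans ?_ (hpowE j)
        gcongr
        exact_mod_cast (by omega : 2 ≤ j + 3)
      calc _ ≤ 2 * (c + 3) * ENNReal.ofReal (R j) ^ d +
            (c + 3 * 1) * ENNReal.ofReal (R (j + 1)) ^ d := by
            refine (hstep j).trans (add_le_add ih ?_)
            gcongr
            exact hη1' j
        _ = (c + 3) * (2 * ENNReal.ofReal (R j) ^ d) +
            (c + 3) * ENNReal.ofReal (R (j + 1)) ^ d := by ring
        _ ≤ (c + 3) * ENNReal.ofReal (R (j + 1)) ^ d +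
            (c + 3) * ENNReal.ofReal (R (j + 1)) ^ d := by gcongr
        _ = _ := by ring
  have hR1 : Tendsto (fun j => R (j + 1)) atTop atTop := hRtop.comp (tendsto_add_atTop_nat 1)
  have hlim : Tendsto (fun j : ℕ => 2 * (c + 3) * ((j + 3 : ℕ) : ℝ≥0∞)⁻¹ +
      (c + 3 * ENNReal.ofReal (η j))) atTop (𝓝 (2 * (c + 3) * 0 + (c + 3 * 0))) := by
    refine Tendsto.add (ENNReal.Tendsto.const_mul ?_ (Or.inr (by finiteness)))
      (tendsto_const_nhds.add (ENNReal.Tendsto.const_mul ?_ (Or.inr (by simp))))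
    · exact ENNReal.tendsto_inv_nat_nhds_zero.comp (tendsto_add_atTop_nat 3)
    · simpa using ENNReal.tendsto_ofReal hη
  simp only [mul_zero, zero_add, add_zero] at hlim
  refine le_of_forall_gt_imp_ge_of_dense fun a ha => ?_
  refine liminf_le_of_frequently_le (hR1.frequently (Eventually.frequently ?_))
    (by isBoundedDefault)
  filter_upwards [hlim.eventually (gt_mem_nhds ha)] with j hj
  have hr0 : ENNReal.ofReal (R (j + 1)) ^ d ≠ 0 := pow_ne_zero _ (by simpa using hRpos (j + 1))
  refine le_trans ?_ hj.le
  rw [ENNReal.div_le_iff hr0 (by finiteness), add_mul]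
  refine (hstep j).trans (add_le_add ((hM j).trans ?_) le_rfl)
  rw [mul_assoc (2 * (c + 3))]
  refine mul_le_mul' le_rfl ?_
  rw [mul_comm, ← div_eq_mul_inv, ENNReal.le_div_iff_mul_le (Or.inl (by simp)) (Or.inl (by simp)),
    mul_comm]
  exact hpowE j

/-- D_j is within η_j of optimal and R_j lies beyond the radius where D_j shows its asymptotic
behaviour. The gap has relative width η_j → 0, so it costs no density. Of the error 3η_j, one η_j is
the defect of D_j and two come from the interaction across the gap. -/
theorem exists_energy_le (hd : 0 < d) {s : ℝ} (hs : (d : ℝ) < s) :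
    ∃ C ∈ configOfDensity d 1, C.energy s ≤ asymptoticMinEnergy d s := by
  have hs0 : 0 < s := lt_of_le_of_lt (by positivity) hs
  set c := asymptoticMinEnergy d s with hcdef
  have hc : c ≠ ⊤ := (asymptoticMinEnergy_lt_top hd hs).ne
  set η : ℕ → ℝ := fun j => 1 / ((j : ℝ) + 1) with hηdef
  have hη0 : ∀ j, 0 < η j := fun j => by positivity
  have hη1 : ∀ j, η j ≤ 1 := fun j => by
    rw [hηdef]
    exact (div_le_one (by positivity)).2 (by linarith [Nat.cast_nonneg (α := ℝ) j])
  have hηlim : Tendsto η atTop (𝓝 0) := tendsto_one_div_add_atTop_nhds_zero_nat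
  have hD : ∀ j, ∃ D : Config d, D.HasUnitDensity ∧ limsup (fun R : ℝ =>
      D.interaction s (cube d R) (cube d R) / ENNReal.ofReal R ^ d) atTop <
      c + ENNReal.ofReal (η j) := fun j =>
    exists_nearly_optimal hd hs (ENNReal.lt_add_right hc (by simpa using hη0 j))
  choose D hDd hDE using hD
  have hT : ∀ j, ∃ T : ℝ, ∀ x ≥ T,
      ((1 - η j) * x ^ d ≤ (D j).num x ∧ (D j).num x ≤ (1 + η j) * x ^ d) ∧
      (0 < x ∧ (D j).interaction s (cube d x) (cube d x) / ENNReal.ofReal x ^ d <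
        c + ENNReal.ofReal (η j)) ∧
      ENNReal.ofReal (6 * x ^ d) * ENNReal.ofReal (η j * x / 2) ^ (-s) ≤ ENNReal.ofReal (η j) :=
    fun j => eventually_atTop.1 (((hDd j).eventually_num (hη0 j)).and
      (((eventually_gt_atTop 0).and (eventually_lt_of_limsup_lt (hDE j))).and
        (eventually_ofReal_rpow_mul_le hs (hη0 j))))
  choose T hT using hT
  obtain ⟨R, hRT, hR1, hRstep⟩ := exists_growing_radii T
  have hRpos : ∀ j, 0 < R j := fun j => lt_of_lt_of_le (by positivity) (hR1 j)
  have hle : ∀ j, R j ≤ R (j + 1) := fun j => by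
    have := hRstep j
    have hj : (0 : ℝ) ≤ j := by positivity
    nlinarith [hRpos j]
  have hRtop : Tendsto R atTop atTop :=
    tendsto_atTop_mono hR1 (tendsto_atTop_add_const_right _ 1 tendsto_natCast_atTop_atTop)
  have hpow : ∀ j : ℕ, ((j : ℝ) + 3) * R j ^ d ≤ R (j + 1) ^ d := fun j =>
    add_three_mul_pow_le hd (hRpos j).le (hRstep j)
  obtain ⟨C, hC0, hCgap, hCD⟩ := exists_shellConfig D (r := fun j => (1 + η j) * R j) hRtop
    (monotone_nat_of_le_succ hle)
  have hcount0 : C.count (cube d (R 0)) = 0 := by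
    rw [Config.count]
    exact ENNReal.tsum_eq_zero.2 fun p => by simp [hC0 p p.2]
  have hr : ∀ j, R j ≤ (1 + η j) * R j := fun j => by nlinarith [hη0 j, hRpos j]
  obtain ⟨h3, hupper, hlower⟩ := num_bounds_of_shells (C := C) (D := D) (R := R) (η := η) hd hη0
    hη1 hR1 hRstep (fun j x hx => (hT j x ((hRT j).trans hx)).1) (by simp [Config.num, hcount0])
    (fun j x hx => count_shell_le (hCgap j) (hCD j) hx)
    (fun j x hx hx' => le_count_shell (hCD j) (hr j) hx hx')
  refine ⟨C, ?_, ?_⟩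
  · have hinv : ∀ b : ℝ, Tendsto (fun j : ℕ => b / ((j : ℝ) + 3)) atTop (𝓝 0) := fun b =>
      tendsto_const_nhds.div_atTop
        (tendsto_atTop_add_const_right _ 3 tendsto_natCast_atTop_atTop)
    have hη' : Tendsto (fun j => η (j + 1)) atTop (𝓝 0) := hηlim.comp (tendsto_add_atTop_nat 1)
    refine density_eq_one_of_num hRtop ?_ ?_ hupper hlower
    · simpa using hηlim.add (hinv 3)
    · have h1 := ((hη'.const_add 1).pow (d + 1)).sub_const 1
      simpa using hη'.add ((h1.add hηlim).add (hinv (2 ^ (d + 1))))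
  · refine energy_le_of_recursion hc hηlim hη1 hRpos hRtop hpow ?_ fun j => ?_
    · rw [Config.interaction]
      refine ENNReal.tsum_eq_zero.2 fun p => ENNReal.tsum_eq_zero.2 fun q => ?_
      simp [Config.pairs, hC0 p p.2]
    · refine (interaction_shell_le hs0.le (hCgap j) (hCD j)).trans ?_
      rw [add_assoc]
      gcongr
      obtain ⟨⟨-, hn⟩, ⟨-, hE⟩, -⟩ := hT j (R (j + 1)) ((hRT j).trans (hle j))
      obtain ⟨-, -, hg⟩ := hT j (R j) (hRT j)
      have hr0 : ENNReal.ofReal (R (j + 1)) ^ d ≠ 0 :=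
        pow_ne_zero _ (by simpa using hRpos (j + 1))
      have hE' := (ENNReal.div_le_iff hr0 (by finiteness)).1 hE.le
      have hcross : C.count (cube d (R j)) * (D j).count (cube d (R (j + 1))) *
          ENNReal.ofReal (((1 + η j) * R j - R j) / 2) ^ (-s) ≤
          ENNReal.ofReal (η j) * ENNReal.ofReal (R (j + 1)) ^ d := by
        rw [show (1 + η j) * R j - R j = η j * R j by ring]
        have a1 : C.count (cube d (R j)) ≤ ENNReal.ofReal (3 * R j ^ d) := by
          rw [← C.ofReal_num]; exact ENNReal.ofReal_le_ofReal (h3 j)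
        have a2 : (D j).count (cube d (R (j + 1))) ≤ 2 * ENNReal.ofReal (R (j + 1)) ^ d := by
          rw [← (D j).ofReal_num, ← ENNReal.ofReal_pow (hRpos _).le, ← ENNReal.ofReal_ofNat,
            ← ENNReal.ofReal_mul (by norm_num)]
          refine ENNReal.ofReal_le_ofReal (hn.trans ?_)
          have := pow_nonneg (hRpos (j + 1)).le d
          gcongr
          linarith [hη1 j]
        have a3 : ENNReal.ofReal (6 * R j ^ d) = ENNReal.ofReal (3 * R j ^ d) * 2 := by
          rw [← ENNReal.ofReal_ofNat 2, ← ENNReal.ofReal_mul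
            (mul_nonneg (by norm_num) (pow_nonneg (hRpos j).le d))]
          congr 1
          ring
        rw [a3] at hg
        calc _ ≤ ENNReal.ofReal (3 * R j ^ d) * (2 * ENNReal.ofReal (R (j + 1)) ^ d) *
              ENNReal.ofReal (η j * R j / 2) ^ (-s) := by gcongr
          _ = (ENNReal.ofReal (3 * R j ^ d) * 2 * ENNReal.ofReal (η j * R j / 2) ^ (-s)) *
              ENNReal.ofReal (R (j + 1)) ^ d := by ring
          _ ≤ _ := by gcongr
      calc _ ≤ (c + ENNReal.ofReal (η j)) * ENNReal.ofReal (R (j + 1)) ^ d +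
            2 * (ENNReal.ofReal (η j) * ENNReal.ofReal (R (j + 1)) ^ d) := by gcongr
        _ = _ := by ring

end HypersingularRiesz

end

/-! ### The main theorem -/

theorem mainTheorem6 (d : ℕ) (hd : 0 < d) (s : ℝ) (hs : (d : ℝ) < s) :
    -- the limit defining `C_{s,d}` exists and is a positive real number
    (Tendsto (HypersingularRiesz.scaledMinEnergy d s) atTop
        (𝓝 (HypersingularRiesz.asymptoticMinEnergy d s)) ∧
      0 < HypersingularRiesz.asymptoticMinEnergy d s ∧
      HypersingularRiesz.asymptoticMinEnergy d s < ⊤) ∧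
    -- the infimum of the energy over configurations of density `1` equals `C_{s,d}`
    (⨅ C ∈ HypersingularRiesz.configOfDensity d 1,
        HypersingularRiesz.Config.energy s C) = HypersingularRiesz.asymptoticMinEnergy d s ∧
    -- and it is attained
    (∃ C ∈ HypersingularRiesz.configOfDensity d 1,
        HypersingularRiesz.Config.energy s C = HypersingularRiesz.asymptoticMinEnergy d s) ∧
    -- for every Bravais lattice of covolume `1` there is a periodic minimizing sequence
    (∀ (Λ : Submodule ℤ (HypersingularRiesz.Space d)) [DiscreteTopology Λ] [IsZLattice ℝ Λ],
      ZLattice.covolume Λ = 1 →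
      ∃ C : ℕ → HypersingularRiesz.Config d,
        (∀ N : ℕ, 1 ≤ N → C N ∈ HypersingularRiesz.configOfDensity d 1 ∧
          HypersingularRiesz.Config.IsPeriodic (C N) ((N : ℝ) ^ (1 / (d : ℝ))) Λ) ∧
        Tendsto (fun N => HypersingularRiesz.Config.energy s (C N)) atTop
          (𝓝 (HypersingularRiesz.asymptoticMinEnergy d s))) := by
  open HypersingularRiesz in
  obtain ⟨C, hC, hE⟩ := exists_energy_le hd hs
  have hCE := le_antisymm hE (asymptoticMinEnergy_le_energy hd hs hC)
  refine ⟨⟨tendsto_scaledMinEnergy hd hs, asymptoticMinEnergy_pos hd hs,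
    asymptoticMinEnergy_lt_top hd hs⟩, ?_, ⟨C, hC, hCE⟩, fun Λ _ _ hΛ => ?_⟩
  · refine le_antisymm ((iInf₂_le C hC).trans hE) (le_iInf₂ fun C' hC' => ?_)
    exact asymptoticMinEnergy_le_energy hd hs hC'
  · obtain ⟨C, hC, hE⟩ := exists_periodic_sequence Λ hd hΛ hs
    refine ⟨C, fun N hN => ⟨(hC N hN).1.mem, (hC N hN).2⟩, tendsto_order.2 ⟨fun a ha => ?_,
      fun a ha => ?_⟩⟩
    -- The lower bound holds for every configuration of density 1; the upper bound below follows
    -- from liminf ≤ limsup.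
    · filter_upwards [eventually_ge_atTop 1] with N hN
      exact ha.trans_le (asymptoticMinEnergy_le_energy hd hs (hC N hN).1.mem)
    · filter_upwards [hE a ha] with N hN
      exact (liminf_le_limsup (by isBoundedDefault) (by isBoundedDefault)).trans_lt hN
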